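/- Let $n\ge 0$, fix a monomial order on $\mathbb{R}[\boldsymbol X]=\mathbb{R}[X_1,\dots,X_n]$, and work in exact real arithmetic (field operations and tests for zero are elementary steps). For an ideal $I\subseteq\mathbb{R}[\boldsymbol X]$ say that $\mathbb{R}[\boldsymbol X]/I$ is a *Weil algebra* if $\langle X_1,\dots,X_n\rangle^k\subseteq I$ for some $k\in\mathbb{N}$. A *Weil setting* of $W=\mathbb{R}[\boldsymbol X]/I$ consists of (1) monomials $\boldsymbol b_1,\dots,\boldsymbol b_\ell$ whose classes form an $\mathbb{R}$-basis of $W$; (2) the multiplication table $M$ of $W$, i.e. for each pair $(\boldsymbol b_s,\boldsymbol b_t)$ the coordinates of $[\boldsymbol b_s\boldsymbol b_t]_I$ in this basis; (3) $(k_1,\dots,k_n)\in\mathbb{N}^n$ where $k_i$ is the maximal exponent with $X_i^{k_i}\notin I$ (no condition if $I=\mathbb{R}[\boldsymbol X]$, where there is no such exponent); (4) a table $\mathrm{NonVan}_W$ whose keys are exactly the monomials $\boldsymbol X^\alpha$ with $\alpha_i\le k_i$ for all $i$, and whose entry at $\boldsymbol X^\alpha$ is the vector $(c_1,\dots,c_\ell)\in\mathbb{R}^\ell$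 with $[\boldsymbol X^\alpha]_I=\sum_j c_j[\boldsymbol b_j]_I$. The procedure WeilTest takes a finite list of generators of an ideal $I$ and runs as follows. Compute a Gröbner basis $G$ of $I$ (Buchberger's algorithm). If $I$ is not zero-dimensional, i.e. if for some $i$ no power of $X_i$ is a leading monomial of an element of $G$, return "No". Let $\boldsymbol b_1,\dots,\boldsymbol b_\ell$ be the monomials not divisible by any leading monomial of $G$, and compute $M$ by taking remainders modulo $G$. For $i=1,\dots,n$ compute the monic generator $p_i$ of $I\cap\mathbb{R}[X_i]$ (from the first linear dependence among the remainders of $1,X_i,X_i^2,\dots$ modulo $G$); if $p_i$ is not a monomial, return "No"; otherwise put $k_i=\max(\deg p_i-1,0)$. For all $\alpha\in\mathbb{N}^n$ with $\alpha_i\le k_i$ for all $i$, let $\mathrm{NonVan}_W(\boldsymbol X^\alpha)$ be the coefficient vector $(c_1,\dots,c_\ell)$ of the remainder $c_1\boldsymbol b_1+\dots+c_\ell\boldsymbol b_\ell$ of $\boldsymbol X^\alpha$ modulo $G$. Return $((\boldsymbol b_1,\dots,\boldsymbol b_\ell),M,(k_1,\dots,k_n),\mathrm{NonVan}_W)$.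 **Theorem.** Every ideal $I\subseteq\mathbb{R}[\boldsymbol X]$ has a finite list of generators, and on every such list WeilTest terminates. It returns "No" if and only if $\mathbb{R}[\boldsymbol X]/I$ is not a Weil algebra; if $\mathbb{R}[\boldsymbol X]/I$ is a Weil algebra, it returns a Weil setting of it. Moreover, for every ideal $I$ and every $i$, the class of $X_i$ in $\mathbb{R}[\boldsymbol X]/I$ is nilpotent if and only if $I\cap\mathbb{R}[X_i]$ has a monic generator and this generator is a monomial $X_i^d$. -/

import Mathlib

/-! ### Sparse polynomials

The procedure below is written without `noncomputable`, over an arbitrary field `K` with a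
test for equality: it consists of field operations, tests for zero, comparisons of monomials and
list processing only.
Loops without an a priori bound are `PFun.fix` in the monad `Part`, so that `Part.Dom` says that
a computation terminates. At `K = ℝ` this is exact real arithmetic with zero tests. -/

/-- A polynomial in `X_1, …, X_n` as a list of terms `(α, c)`, standing for the sum of the
`c X^α`; repeated exponents and zero coefficients are allowed. -/
abbrev SPoly (n : ℕ) (K : Type) : Type := List ((Fin n → ℕ) × K)

/-- An exponent vector as a finitely supported function. -/
def expo {n : ℕ} (a : Fin n → ℕ) : Fin n →₀ ℕ :=
  ⟨Finset.univ.filter (fun i => a i ≠ 0), a, by simp⟩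

/-- The element of `K[X_1, …, X_n]` represented by a list of terms. -/
noncomputable def SPoly.toMv {n : ℕ} {K : Type} [Field K] (p : SPoly n K) :
    MvPolynomial (Fin n) K :=
  (p.map fun t => MvPolynomial.monomial (expo t.1) t.2).sum

/-- The ideal generated by a finite list of polynomials. -/
noncomputable def idealOf {n : ℕ} {K : Type} [Field K] (F : List (SPoly n K)) :
    Ideal (MvPolynomial (Fin n) K) :=
  Ideal.span {f | ∃ p ∈ F, f = SPoly.toMv p}

/-- A comparison of exponent vectors, as it is handed to the procedure. -/
abbrev OrderTest (n : ℕ) : Type := (Fin n → ℕ) → (Fin n → ℕ) → Bool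

/-- The comparison `X^a ≤ X^b` of a monomial order. -/
noncomputable def MonomialOrder.test {n : ℕ} (m : MonomialOrder (Fin n)) : OrderTest n :=
  fun a b => decide (m.toSyn (expo a) ≤ m.toSyn (expo b))

namespace WeilAlg

section Procedure

variable {n : ℕ} {K : Type} [Field K] [DecidableEq K]

/-- The coefficient of `X^a`. -/
def coeff (p : SPoly n K) (a : Fin n → ℕ) : K :=
  ((p.filter fun t => t.1 = a).map Prod.snd).sum

/-- The exponents that occur with a nonzero coefficient. -/
def supp (p : SPoly n K) : List (Fin n → ℕ) :=
  (p.map Prod.fst).dedup.filter fun a => coeff p a ≠ 0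

/-- `c X^a p`. -/
def mulTerm (a : Fin n → ℕ) (c : K) (p : SPoly n K) : SPoly n K :=
  p.map fun t => (a + t.1, c * t.2)

/-- `p - c X^a q`. -/
def subMul (p : SPoly n K) (a : Fin n → ℕ) (c : K) (q : SPoly n K) : SPoly n K :=
  p ++ mulTerm a (-c) q

/-- `X^a ∣ X^b`. -/
def divides (a b : Fin n → ℕ) : Bool := decide (∀ i, a i ≤ b i)

/-- The leading exponent for the monomial order `m`; `none` for the zero polynomial. -/
def lm (m : OrderTest n) (p : SPoly n K) : Option (Fin n → ℕ) :=
  match supp p with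
  | [] => none
  | a :: l => some (l.foldl (fun b c => if m b c = true then c else b) a)

/-- The leading exponent of `g` divides `a`. -/
def lmDivides (m : OrderTest n) (a : Fin n → ℕ) (g : SPoly n K) : Bool :=
  match lm m g with
  | none => false
  | some b => divides b a

/-- One step of the division by `G`, on a pair of a polynomial that is still to be divided and the
remainder collected so far: the leading term of the former is cancelled by the first
suitable element of `G`, or moved to the remainder if there is none. -/
def remStep (m : OrderTest n) (G : List (SPoly n K)) (s : SPoly n K × SPoly n K) :
    SPoly n K ⊕ (SPoly n K × SPoly n K) :=
  match lm m s.1 with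
  | none => Sum.inl s.2
  | some a =>
    match G.find? (lmDivides m a) with
    | none => Sum.inr (subMul s.1 a (coeff s.1 a) [(0, 1)], (a, coeff s.1 a) :: s.2)
    | some g =>
      match lm m g with
      | none => Sum.inl s.2
      | some b => Sum.inr (subMul s.1 (a - b) (coeff s.1 a / coeff g b) g, s.2)

/-- The remainder of `p` on division by `G`. -/
def rem (m : OrderTest n) (G : List (SPoly n K)) (p : SPoly n K) : Part (SPoly n K) :=
  PFun.fix (fun s => Part.some (remStep m G s)) (p, [])

/-- The S-polynomial. -/
def sPoly (m : OrderTest n) (f g : SPoly n K) : SPoly n K :=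
  match lm m f, lm m g with
  | some a, some b =>
      subMul (mulTerm (a ⊔ b - a) (coeff f a)⁻¹ f) (a ⊔ b - b) (coeff g b)⁻¹ g
  | _, _ => []

/-- The pairs of entries at different places of a list. -/
def pairs {α : Type} : List α → List (α × α)
  | [] => []
  | x :: l => l.map (fun y => (x, y)) ++ pairs l

/-- One step of Buchberger's algorithm, on a pair of the current list of generators and the
list of pairs whose S-polynomials are still to be treated. -/
def buchbergerStep (m : OrderTest n)
    (s : List (SPoly n K) × List (SPoly n K × SPoly n K)) :
    Part (List (SPoly n K) ⊕ (List (SPoly n K) × List (SPoly n K × SPoly n K))) :=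
  match s.2 with
  | [] => Part.some (Sum.inl s.1)
  | (f, g) :: P =>
    (rem m s.1 (sPoly m f g)).bind fun r =>
      Part.some <| Sum.inr <|
        if supp r = [] then (s.1, P) else (r :: s.1, s.1.map (fun h => (r, h)) ++ P)

/-- Buchberger's algorithm: a Gröbner basis of the ideal generated by `F`. -/
def calcGroebnerBasis (m : OrderTest n) (F : List (SPoly n K)) :
    Part (List (SPoly n K)) :=
  PFun.fix (buchbergerStep m)
    (F.filter (fun f => supp f ≠ []), pairs (F.filter fun f => supp f ≠ []))

/-- The exponent `d` of a leading monomial `X_i^d` of an element of `G`, if there is one. -/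
def purePower? (m : OrderTest n) (G : List (SPoly n K)) (i : Fin n) : Option ℕ :=
  G.findSome? fun g =>
    match lm m g with
    | none => none
    | some a => if a = Pi.single i (a i) then some (a i) else none

/-- The test for zero-dimensionality of the ideal with Gröbner basis `G`: for every variable, a
power of it is the leading monomial of an element of `G`. -/
def zeroDimensional (m : OrderTest n) (G : List (SPoly n K)) : Bool :=
  decide (∀ i, (purePower? m G i).isSome = true)

/-- All `α` with `α_i < d_i` for all `i`. -/
def box : (n : ℕ) → (Fin n → ℕ) → List (Fin n → ℕ)
  | 0, _ => [Fin.elim0]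
  | n + 1, d =>
      (List.range (d 0)).flatMap fun a =>
        (box n fun i => d i.succ).map fun α => (Fin.cons a α : Fin (n + 1) → ℕ)

/-- The standard monomials of a zero-dimensional Gröbner basis `G`: the monomials that no leading
monomial of `G` divides. -/
def monomialBasis (m : OrderTest n) (G : List (SPoly n K)) : List (Fin n → ℕ) :=
  (box n fun i => (purePower? m G i).getD 0).filter fun a => !(G.any (lmDivides m a))

/-- The coefficients of the remainder of `X^a` at the monomials in `B`. -/
def normalForm (m : OrderTest n) (G : List (SPoly n K)) (B : List (Fin n → ℕ))
    (a : Fin n → ℕ) : Part (List K) :=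
  (rem m G [(a, 1)]).bind fun r => Part.some (B.map (coeff r))

/-- The multiplication table: the entry at a pair of basis monomials lists the coordinates of
their product. -/
def multTable (m : OrderTest n) (G : List (SPoly n K)) (B : List (Fin n → ℕ)) :
    Part (List (((Fin n → ℕ) × (Fin n → ℕ)) × List K)) :=
  (B ×ˢ B).mapM fun ab => (normalForm m G B (ab.1 + ab.2)).bind fun c => Part.some (ab, c)

/-- One step of Gaussian elimination on a pair `(v, q)`, with the row `e` and its
leading exponent as the pivot. -/
def eliminate (m : OrderTest n) (v e : SPoly n K × SPoly n K) :
    SPoly n K × SPoly n K :=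
  match lm m e.1 with
  | none => v
  | some a =>
      (subMul v.1 0 (coeff v.1 a / coeff e.1 a) e.1, subMul v.2 0 (coeff v.1 a / coeff e.1 a) e.2)

/-- One step of the search for the first linear dependence among the remainders of
`1, X_i, X_i^2, …`. The state is the next exponent `j` and the list of rows `(v, q)` so far,
where `q` is a polynomial in `X_i` and `v` is its remainder. -/
def monicGeneratorStep (m : OrderTest n) (G : List (SPoly n K)) (i : Fin n)
    (s : ℕ × List (SPoly n K × SPoly n K)) :
    Part ((SPoly n K × ℕ) ⊕ (ℕ × List (SPoly n K × SPoly n K))) :=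
  (rem m G [(Pi.single i s.1, 1)]).bind fun v =>
    let w := s.2.foldl (eliminate m) (v, [(Pi.single i s.1, 1)])
    Part.some <| if supp w.1 = [] then Sum.inl (w.2, s.1) else Sum.inr (s.1 + 1, s.2 ++ [w])

/-- The monic generator of `I ∩ K[X_i]`, with its degree. -/
def monicGenerator (m : OrderTest n) (G : List (SPoly n K)) (i : Fin n) :
    Part (SPoly n K × ℕ) :=
  PFun.fix (monicGeneratorStep m G i) (0, [])

/-- The loop over the variables: `none` as soon as the monic generator for one of them is not a
monomial; otherwise the exponents `k_i = deg p_i - 1` are entered into `k`. -/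
def maxPowers (m : OrderTest n) (G : List (SPoly n K)) :
    List (Fin n) → (Fin n → ℕ) → Part (Option (Fin n → ℕ))
  | [], k => Part.some (some k)
  | i :: l, k =>
    (monicGenerator m G i).bind fun p =>
      if (supp p.1).length = 1 then maxPowers m G l (Function.update k i (p.2 - 1))
      else Part.some none

/-- The table of the coordinates of all `X^α` with `α_i ≤ k_i` for all `i`. -/
def nonVanTable (m : OrderTest n) (G : List (SPoly n K)) (B : List (Fin n → ℕ))
    (k : Fin n → ℕ) : Part (List ((Fin n → ℕ) × List K)) :=
  (box n fun i => k i + 1).mapM fun a =>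
    (normalForm m G B a).bind fun c => Part.some (a, c)

end Procedure

end WeilAlg

/-- The data that make up a Weil setting; monomials are given by their exponents, and tables as
lists of pairs of a key and a list of coordinates. -/
structure WeilSetting (n : ℕ) (K : Type) where
  basis : List (Fin n → ℕ)
  table : List (((Fin n → ℕ) × (Fin n → ℕ)) × List K)
  k : Fin n → ℕ
  nonVan : List ((Fin n → ℕ) × List K)

open WeilAlg in
/-- The procedure WeilTest, on a finite list of generators of the ideal and with the comparison of a
monomial order for the Gröbner basis computation. The answer "No" is `none`. -/
def weilTest {n : ℕ} {K : Type} [Field K] [DecidableEq K] (m : OrderTest n)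
    (F : List (SPoly n K)) : Part (Option (WeilSetting n K)) :=
  (calcGroebnerBasis m F).bind fun G =>
    if zeroDimensional m G = false then Part.some none
    else
      (multTable m G (monomialBasis m G)).bind fun M =>
        (maxPowers m G (List.finRange n) 0).bind fun k? =>
          match k? with
          | none => Part.some none
          | some k =>
            (nonVanTable m G (monomialBasis m G) k).bind fun N =>
              Part.some (some ⟨monomialBasis m G, M, k, N⟩)

/-! ### The specification -/

/-- `ℝ[X_1, …, X_n]/I` is a Weil algebra: `⟨X_1, …, X_n⟩^k ⊆ I` for some `k`. -/
def IsWeil {n : ℕ} (I : Ideal (MvPolynomial (Fin n) ℝ)) : Prop :=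
  ∃ k : ℕ, Ideal.span (Set.range (MvPolynomial.X : Fin n → MvPolynomial (Fin n) ℝ)) ^ k ≤ I

/-- The class of `X^a` in `ℝ[X_1, …, X_n]/I`. -/
noncomputable def monomialClass {n : ℕ} (I : Ideal (MvPolynomial (Fin n) ℝ)) (a : Fin n → ℕ) :
    MvPolynomial (Fin n) ℝ ⧸ I :=
  Ideal.Quotient.mk I (MvPolynomial.monomial (expo a) 1)

/-- `w = c_1 b_1 + ⋯ + c_ℓ b_ℓ` in `ℝ[X_1, …, X_n]/I`, for the monomials `b_j` listed in `B`. -/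
def IsCoords {n : ℕ} (I : Ideal (MvPolynomial (Fin n) ℝ)) (B : List (Fin n → ℕ)) (c : List ℝ)
    (w : MvPolynomial (Fin n) ℝ ⧸ I) : Prop :=
  c.length = B.length ∧ w = (List.zipWith (fun r b => r • monomialClass I b) c B).sum

/-- `S` is a Weil setting of `ℝ[X_1, …, X_n]/I`. The clause on `k` is void for the
zero ring, where no power of a variable is nonzero. -/
structure IsWeilSetting {n : ℕ} (I : Ideal (MvPolynomial (Fin n) ℝ)) (S : WeilSetting n ℝ) :
    Prop where
  linearIndependent :
    LinearIndependent ℝ fun j : Fin S.basis.length => monomialClass I (S.basis.get j)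
  span_eq_top :
    Submodule.span ℝ (Set.range fun j : Fin S.basis.length => monomialClass I (S.basis.get j)) = ⊤
  table_keys : ∀ a b, (∃ c, ((a, b), c) ∈ S.table) ↔ a ∈ S.basis ∧ b ∈ S.basis
  table_spec : ∀ a b c, ((a, b), c) ∈ S.table →
    IsCoords I S.basis c (monomialClass I a * monomialClass I b)
  k_spec : I ≠ ⊤ → ∀ i,
    IsGreatest {j : ℕ | (MvPolynomial.X i : MvPolynomial (Fin n) ℝ) ^ j ∉ I} (S.k i)
  nonVan_keys : ∀ a, (∃ c, (a, c) ∈ S.nonVan) ↔ ∀ i, a i ≤ S.k i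
  nonVan_spec : ∀ a c, (a, c) ∈ S.nonVan → IsCoords I S.basis c (monomialClass I a)

/-! ### Lists of terms and the polynomials they represent -/

/-! Two algebraic facts decide the answer. First, the quotient is a Weil algebra exactly when `I`
contains a power of every variable: a finitely generated ideal inside the radical of `I` has a power
inside `I` (`isWeil_iff_exists_pow_mem`). Second, let `P` be monic of least degree `d` with `P(X_i)
∈ I`. If `X_i^e ∈ I`, then `P` divides `X^e`, and as `X` is prime, `P = X^d`
(`eq_X_pow_of_X_pow_mem`). In that case `X_i^e ∈ I` holds exactly for `d ≤ e`, which gives the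
exponents `k_i`.

The rest is total correctness of the computations. Every loop gets an invariant and a well-founded
measure (`PFun.exists_mem_fix`). Division lowers the leading exponent. Buchberger's algorithm either
enlarges the ideal of leading monomials, which can happen only finitely often, or uses up a pair.
Its result is a Gröbner basis by Buchberger's criterion, proved with the spaces `repSpan` of
combinations whose terms have bounded leading exponents: if all S-polynomials have representations
below the least common multiple, then all multiples of generators with a given leading exponent are
proportional modulo smaller ones.

For a Gröbner basis, 0 is the only reduced element of `I` (`IsGroebner.eq_zero_of_mem_reduced`).
Hence the standard monomials form a basis of the quotient and remainders give coordinates. The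
search for `P` is Gaussian elimination on remainders. Its pivots are distinct standard monomials, so
finiteness of their number ends the search. -/

@[simp] theorem expo_apply {n : ℕ} (a : Fin n → ℕ) (i : Fin n) : expo a i = a i := rfl

@[simp] theorem expo_coe {n : ℕ} (s : Fin n →₀ ℕ) : expo (⇑s) = s := by ext; simp

@[simp] theorem coe_expo {n : ℕ} (a : Fin n → ℕ) : ⇑(expo a) = a := rfl

theorem expo_injective {n : ℕ} : Function.Injective (expo (n := n)) := fun a b h => by
  rw [← coe_expo a, h, coe_expo]

@[simp] theorem expo_inj {n : ℕ} {a b : Fin n → ℕ} : expo a = expo b ↔ a = b :=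
  expo_injective.eq_iff

theorem expo_add {n : ℕ} (a b : Fin n → ℕ) : expo (a + b) = expo a + expo b := by ext; simp

theorem expo_sub {n : ℕ} (a b : Fin n → ℕ) : expo (a - b) = expo a - expo b := by ext; simp

theorem expo_sup {n : ℕ} (a b : Fin n → ℕ) : expo (a ⊔ b) = expo a ⊔ expo b := by ext; simp

@[simp] theorem expo_zero {n : ℕ} : expo (0 : Fin n → ℕ) = 0 := by ext; simp

theorem expo_le {n : ℕ} {a b : Fin n → ℕ} : expo a ≤ expo b ↔ a ≤ b := Iff.rfl

theorem expo_single {n : ℕ} (i : Fin n) (d : ℕ) : expo (Pi.single i d) = Finsupp.single i d := by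
  ext j; simp [Finsupp.single_apply, Pi.single_apply, eq_comm]

namespace SPoly

variable {n : ℕ} {K : Type} [Field K]

@[simp] theorem toMv_nil : toMv ([] : SPoly n K) = 0 := rfl

@[simp] theorem toMv_cons (t : (Fin n → ℕ) × K) (p : SPoly n K) :
    toMv (t :: p) = MvPolynomial.monomial (expo t.1) t.2 + toMv p := by
  simp [toMv]

@[simp] theorem toMv_append (p q : SPoly n K) : toMv (p ++ q) = toMv p + toMv q := by
  simp [toMv]

theorem exists_toMv_eq (f : MvPolynomial (Fin n) K) : ∃ p : SPoly n K, toMv p = f := by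
  refine ⟨f.support.toList.map fun s : Fin n →₀ ℕ => (⇑s, f.coeff s), ?_⟩
  conv_rhs => rw [← MvPolynomial.support_sum_monomial_coeff f]
  rw [toMv, List.map_map, ← Finset.sum_map_toList]
  congr 1
  exact List.map_congr_left fun s _ => by simp [Function.comp]

end SPoly

namespace WeilAlg

open SPoly

variable {n : ℕ} {K : Type} [Field K]

theorem coeff_toMv (p : SPoly n K) (a : Fin n → ℕ) : (toMv p).coeff (expo a) = coeff p a := by
  induction p with
  | nil => simp [coeff]
  | cons t p ih =>
    rw [toMv_cons, MvPolynomial.coeff_add, ih, MvPolynomial.coeff_monomial]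
    by_cases h : t.1 = a <;> simp [coeff, h]

theorem toMv_mulTerm (a : Fin n → ℕ) (c : K) (p : SPoly n K) :
    toMv (mulTerm a c p) = MvPolynomial.monomial (expo a) c * toMv p := by
  induction p with
  | nil => simp [mulTerm]
  | cons t p ih =>
    rw [mulTerm, List.map_cons, ← mulTerm, toMv_cons, toMv_cons, ih, mul_add,
      MvPolynomial.monomial_mul, expo_add]

theorem toMv_subMul (p : SPoly n K) (a : Fin n → ℕ) (c : K) (q : SPoly n K) :
    toMv (subMul p a c q) = toMv p - MvPolynomial.monomial (expo a) c * toMv q := by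
  rw [subMul, toMv_append, toMv_mulTerm, map_neg]
  ring

variable [DecidableEq K]

theorem mem_supp {p : SPoly n K} {a : Fin n → ℕ} : a ∈ supp p ↔ coeff p a ≠ 0 := by
  simp only [supp, List.mem_filter, List.mem_dedup, decide_eq_true_eq, and_iff_right_iff_imp]
  intro h
  by_contra ha
  refine h ?_
  rw [coeff, List.filter_eq_nil_iff.2, List.map_nil, List.sum_nil]
  intro t ht hta
  exact ha (List.mem_map.2 ⟨t, ht, by simpa using hta⟩)

theorem nodup_supp (p : SPoly n K) : (supp p).Nodup := (List.nodup_dedup _).filter _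

theorem supp_eq_nil {p : SPoly n K} : supp p = [] ↔ toMv p = 0 := by
  rw [List.eq_nil_iff_forall_not_mem, MvPolynomial.ext_iff]
  refine ⟨fun h s => ?_, fun h a => ?_⟩
  · have := h s
    rw [mem_supp, not_not, ← coeff_toMv, expo_coe] at this
    simpa using this
  · rw [mem_supp, not_not, ← coeff_toMv, h, MvPolynomial.coeff_zero]

theorem foldl_max_spec (m : MonomialOrder (Fin n)) (l : List (Fin n → ℕ)) (a : Fin n → ℕ) :
    l.foldl (fun b c => if m.test b c = true then c else b) a ∈ a :: l ∧
      ∀ b ∈ a :: l, m.toSyn (expo b) ≤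
        m.toSyn (expo (l.foldl (fun b c => if m.test b c = true then c else b) a)) := by
  induction l generalizing a with
  | nil => simp
  | cons c l ih =>
    rw [List.foldl_cons]
    obtain ⟨h1, h2⟩ := ih (if m.test a c = true then c else a)
    refine ⟨?_, fun b hb => ?_⟩
    · rcases List.mem_cons.1 h1 with h | h
      · rw [h]; split_ifs <;> simp
      · simp [h]
    · have h3 := h2 _ List.mem_cons_self
      have h4 : m.toSyn (expo a) ≤ m.toSyn (expo (if m.test a c = true then c else a)) ∧
          m.toSyn (expo c) ≤ m.toSyn (expo (if m.test a c = true then c else a)) := by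
        by_cases hac : m.toSyn (expo a) ≤ m.toSyn (expo c)
        · simp [MonomialOrder.test, hac]
        · simp [MonomialOrder.test, hac, (not_le.1 hac).le]
      rcases List.mem_cons.1 hb with rfl | hb
      · exact h4.1.trans h3
      · rcases List.mem_cons.1 hb with rfl | hb
        · exact h4.2.trans h3
        · exact h2 _ (List.mem_cons_of_mem _ hb)

theorem lm_eq_none {m : OrderTest n} {p : SPoly n K} : lm m p = none ↔ toMv p = 0 := by
  rw [← supp_eq_nil, lm]
  split <;> simp_all

theorem degree_toMv_of_lm {m : MonomialOrder (Fin n)} {p : SPoly n K} {a : Fin n → ℕ}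
    (h : lm m.test p = some a) : m.degree (toMv p) = expo a := by
  rw [lm] at h
  split at h
  · simp at h
  · rename_i b l hl
    obtain ⟨h1, h2⟩ := foldl_max_spec m l b
    rw [← hl, Option.some_inj.1 h] at h1 h2
    apply m.toSyn.injective
    apply le_antisymm
    · rw [MonomialOrder.degree_le_iff]
      intro s hs
      rw [MvPolynomial.mem_support_iff, ← expo_coe s, coeff_toMv, ← mem_supp] at hs
      simpa using h2 _ hs
    · apply MonomialOrder.le_degree
      rw [MvPolynomial.mem_support_iff, coeff_toMv]
      exact mem_supp.1 h1

/-- The link from the computed leading exponent to `MonomialOrder.degree`. Nonvanishing has to be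
stated separately, since the degree of 0 equals that of a nonzero constant. -/
theorem lm_eq_some {m : MonomialOrder (Fin n)} {p : SPoly n K} {a : Fin n → ℕ} :
    lm m.test p = some a ↔ toMv p ≠ 0 ∧ m.degree (toMv p) = expo a := by
  refine ⟨fun h => ⟨fun h0 => ?_, degree_toMv_of_lm h⟩, fun ⟨h0, h⟩ => ?_⟩
  · rw [← lm_eq_none (m := m.test), h] at h0; cases h0
  · rcases hb : lm m.test p with _ | b
    · exact absurd (lm_eq_none.1 hb) h0
    · rw [degree_toMv_of_lm hb] at h
      rw [expo_injective h]

theorem lmDivides_iff {m : MonomialOrder (Fin n)} {a : Fin n → ℕ} {g : SPoly n K} :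
    lmDivides m.test a g = true ↔ toMv g ≠ 0 ∧ m.degree (toMv g) ≤ expo a := by
  rw [lmDivides]
  split
  · rename_i h
    simp [lm_eq_none.1 h]
  · rename_i b h
    rw [lm_eq_some] at h
    simp only [divides, decide_eq_true_eq, h.2, expo_le, ne_eq, h.1, not_false_eq_true, true_and]
    exact Iff.rfl

theorem coeff_eq_leadingCoeff {m : MonomialOrder (Fin n)} {p : SPoly n K} {a : Fin n → ℕ}
    (h : lm m.test p = some a) : coeff p a = m.leadingCoeff (toMv p) := by
  rw [← coeff_toMv, ← degree_toMv_of_lm h]; rfl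

end WeilAlg

/-! ### Total correctness of loops and of list traversals -/

/-- A loop whose steps are defined on an invariant `P` and decrease a well-founded measure ends
with a value that satisfies the postcondition `Q`. -/
theorem PFun.exists_mem_fix {α β γ : Type*} [LT γ] [WellFoundedLT γ] {f : α →. β ⊕ α} (μ : α → γ)
    {P : α → Prop} {Q : β → Prop}
    (step : ∀ a, P a → (∃ b, Sum.inl b ∈ f a ∧ Q b) ∨ ∃ a', Sum.inr a' ∈ f a ∧ P a' ∧ μ a' < μ a)
    (a : α) (ha : P a) : ∃ b ∈ f.fix a, Q b := by
  induction h : μ a using WellFoundedLT.induction generalizing a with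
  | ind c ih =>
    subst h
    rcases step a ha with ⟨b, hb, hQ⟩ | ⟨a', ha', hP, hlt⟩
    · exact ⟨b, PFun.fix_stop hb, hQ⟩
    · obtain ⟨b, hb, hQ⟩ := ih _ hlt a' hP rfl
      exact ⟨b, by rwa [PFun.fix_fwd_eq ha'], hQ⟩

/-- Yields termination and the entrywise specification of a table at once. -/
theorem List.exists_mem_mapM_part {α β : Type} {f : α → Part β} {R : α → β → Prop} {l : List α}
    (h : ∀ a ∈ l, ∃ b ∈ f a, R a b) : ∃ r ∈ l.mapM f, List.Forall₂ R l r := by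
  induction l with
  | nil => exact ⟨[], by simp, .nil⟩
  | cons a l ih =>
    obtain ⟨b, hb, hR⟩ := h a List.mem_cons_self
    obtain ⟨r, hr, hF⟩ := ih fun a ha => h a (List.mem_cons_of_mem _ ha)
    refine ⟨b :: r, ?_, .cons hR hF⟩
    rw [List.mapM_cons]
    simp only [Part.bind_eq_bind, Part.pure_eq_some, Part.mem_bind_iff, Part.mem_some_iff]
    exact ⟨b, hb, r, hr, rfl⟩

theorem List.Forall₂.exists_of_mem_left {α β : Type*} {R : α → β → Prop} {l : List α} {r : List β}
    (h : List.Forall₂ R l r) {a : α} (ha : a ∈ l) : ∃ b ∈ r, R a b := by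
  induction h with
  | nil => simp at ha
  | cons hR _ ih =>
    rcases List.mem_cons.1 ha with rfl | ha
    · exact ⟨_, List.mem_cons_self, hR⟩
    · obtain ⟨b, hb, h⟩ := ih ha
      exact ⟨b, List.mem_cons_of_mem _ hb, h⟩

theorem List.Forall₂.exists_of_mem_right {α β : Type*} {R : α → β → Prop} {l : List α}
    {r : List β} (h : List.Forall₂ R l r) {b : β} (hb : b ∈ r) : ∃ a ∈ l, R a b :=
  h.flip.exists_of_mem_left hb

/-! ### Standard representations and Buchberger's criterion -/

namespace MonomialOrder

open MvPolynomial

section Representations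

variable {σ K : Type*} [Field K] (m : MonomialOrder σ)

/-- The polynomials that are combinations of multiples `X^a g` of elements `g` of `G` with leading
exponents in `S`. -/
noncomputable def repSpan (G : Set (MvPolynomial σ K)) (S : Set m.syn) :
    Submodule K (MvPolynomial σ K) :=
  Submodule.span K {f | ∃ g ∈ G, ∃ a, m.toSyn (a + m.degree g) ∈ S ∧ f = monomial a 1 * g}

variable {m} {G : Set (MvPolynomial σ K)} {S : Set m.syn}

theorem repSpan_mono {G' : Set (MvPolynomial σ K)} {S' : Set m.syn} (hG : G ⊆ G') (hS : S ⊆ S') :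
    m.repSpan G S ≤ m.repSpan G' S' :=
  Submodule.span_mono fun _ ⟨g, hg, a, ha, h⟩ => ⟨g, hG hg, a, hS ha, h⟩

theorem monomial_mul_mem_repSpan {g : MvPolynomial σ K} (hg : g ∈ G) {a : σ →₀ ℕ}
    (ha : m.toSyn (a + m.degree g) ∈ S) (c : K) : monomial a c * g ∈ m.repSpan G S := by
  have : monomial a c * g = c • (monomial a 1 * g) := by
    rw [← smul_mul_assoc, smul_monomial, smul_eq_mul, mul_one]
  rw [this]
  exact Submodule.smul_mem _ _ (Submodule.subset_span ⟨g, hg, a, ha, rfl⟩)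

theorem mul_mem_repSpan {x : MvPolynomial σ K} {S' : Set m.syn} {b : σ →₀ ℕ}
    (hb : ∀ s ∈ S, m.toSyn b + s ∈ S') (c : K) (hx : x ∈ m.repSpan G S) :
    monomial b c * x ∈ m.repSpan G S' := by
  induction hx using Submodule.span_induction with
  | mem x hx =>
    obtain ⟨g, hg, a, ha, rfl⟩ := hx
    rw [← mul_assoc, monomial_mul]
    refine monomial_mul_mem_repSpan hg ?_ _
    rw [add_assoc, map_add]
    exact hb _ ha
  | zero => simp
  | add x y _ _ hx hy => rw [mul_add]; exact add_mem hx hy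
  | smul r x _ hx => rw [mul_smul_comm]; exact Submodule.smul_mem _ _ hx

theorem coeff_eq_zero_of_mem_repSpan {x : MvPolynomial σ K} {e : σ →₀ ℕ}
    (he : ∀ s ∈ S, s < m.toSyn e) (hx : x ∈ m.repSpan G S) : x.coeff e = 0 := by
  induction hx using Submodule.span_induction with
  | mem x hx =>
    obtain ⟨g, hg, a, ha, rfl⟩ := hx
    apply m.coeff_eq_zero_of_lt
    refine lt_of_le_of_lt m.degree_mul_le (lt_of_le_of_lt ?_ (he _ ha))
    rw [map_add, map_add]
    exact add_le_add_left (m.degree_monomial_le _) _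
  | zero => simp
  | add x y _ _ hx hy => simp [hx, hy]
  | smul r x _ hx => simp [hx]

theorem mem_span_of_mem_repSpan {x : MvPolynomial σ K} (hx : x ∈ m.repSpan G S) :
    x ∈ Ideal.span G := by
  induction hx using Submodule.span_induction with
  | mem x hx =>
    obtain ⟨g, hg, a, ha, rfl⟩ := hx
    exact Ideal.mul_mem_left _ _ (Ideal.subset_span hg)
  | zero => simp
  | add x y _ _ hx hy => exact add_mem hx hy
  | smul r x _ hx => rw [← C_mul']; exact Ideal.mul_mem_left _ _ hx

/-- The polynomial coefficients of an ideal combination split into terms. -/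
theorem mem_repSpan_univ {x : MvPolynomial σ K} (hx : x ∈ Ideal.span G) :
    x ∈ m.repSpan G Set.univ := by
  induction hx using Submodule.span_induction with
  | mem x hx =>
    have := monomial_mul_mem_repSpan (m := m) hx (a := 0) (Set.mem_univ _) 1
    rwa [← one_def, one_mul] at this
  | zero => simp
  | add x y _ _ hx hy => exact add_mem hx hy
  | smul r x _ hx =>
    rw [smul_eq_mul]
    induction r using MvPolynomial.induction_on' with
    | monomial b c => exact mul_mem_repSpan (fun _ _ => Set.mem_univ _) c hx
    | add p q hp hq => rw [add_mul]; exact add_mem hp hq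

/-- A combination has finitely many terms, so the largest leading exponent among them serves as `d`.
Zero is excluded because `S` may be empty. This turns a strict bound into a smaller nonstrict one,
as well-founded induction requires. -/
theorem exists_mem_repSpan_Iic {x : MvPolynomial σ K} (hx : x ∈ m.repSpan G S) (h0 : x ≠ 0) :
    ∃ d ∈ S, x ∈ m.repSpan G (Set.Iic d) := by
  have : x = 0 ∨ ∃ d ∈ S, x ∈ m.repSpan G (Set.Iic d) := by
    clear h0
    induction hx using Submodule.span_induction with
    | mem x hx =>
      obtain ⟨g, hg, a, ha, rfl⟩ := hx
      exact Or.inr ⟨_, ha, monomial_mul_mem_repSpan hg (Set.mem_Iic.2 le_rfl) _⟩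
    | zero => exact Or.inl rfl
    | add x y _ _ hx hy =>
      by_cases h0x : x = 0
      · subst h0x; simpa using hy
      by_cases h0y : y = 0
      · subst h0y; simpa using hx
      obtain ⟨d, hd, hx⟩ := hx.resolve_left h0x
      obtain ⟨e, he, hy⟩ := hy.resolve_left h0y
      refine Or.inr ⟨max d e, by rcases max_choice d e with h | h <;> rwa [h], add_mem ?_ ?_⟩
      · exact repSpan_mono subset_rfl (Set.Iic_subset_Iic.2 (le_max_left _ _)) hx
      · exact repSpan_mono subset_rfl (Set.Iic_subset_Iic.2 (le_max_right _ _)) hy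
    | smul r x _ hx =>
      by_cases h0x : x = 0
      · simp [h0x]
      obtain ⟨d, hd, hx⟩ := hx.resolve_left h0x
      exact Or.inr ⟨d, hd, Submodule.smul_mem _ _ hx⟩
  exact this.resolve_left h0

variable (m) in
/-- The S-polynomial of `f` and `g`, normalized to leading coefficients `1`. -/
noncomputable def monicSPolynomial (f g : MvPolynomial σ K) : MvPolynomial σ K :=
  monomial (m.degree f ⊔ m.degree g - m.degree f) (m.leadingCoeff f)⁻¹ * f -
    monomial (m.degree f ⊔ m.degree g - m.degree g) (m.leadingCoeff g)⁻¹ * g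

theorem monicSPolynomial_self (f : MvPolynomial σ K) : m.monicSPolynomial f f = 0 := by
  simp [monicSPolynomial]

theorem monicSPolynomial_swap (f g : MvPolynomial σ K) :
    m.monicSPolynomial g f = -m.monicSPolynomial f g := by
  simp [monicSPolynomial, sup_comm]

theorem monicSPolynomial_mem {I : Ideal (MvPolynomial σ K)} {f g : MvPolynomial σ K}
    (hf : f ∈ I) (hg : g ∈ I) : m.monicSPolynomial f g ∈ I :=
  sub_mem (Ideal.mul_mem_left _ _ hf) (Ideal.mul_mem_left _ _ hg)

theorem coeff_add_degree_monomial_mul (a : σ →₀ ℕ) (c : K) (g : MvPolynomial σ K) :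
    (monomial a c * g).coeff (a + m.degree g) = c * m.leadingCoeff g := by
  rw [coeff_monomial_mul]; rfl

theorem lt_of_coeff_eq_zero {x : MvPolynomial σ K} {d : m.syn}
    (h : ∀ e, d ≤ m.toSyn e → x.coeff e = 0) (hx : x ≠ 0) : m.toSyn (m.degree x) < d := by
  by_contra hd
  exact m.coeff_degree_ne_zero_iff.2 hx (h _ (not_lt.1 hd))

theorem degree_sub_lt_of_coeff_eq {f g : MvPolynomial σ K} {a : σ →₀ ℕ}
    (hf : m.toSyn (m.degree f) ≤ m.toSyn a) (hg : m.toSyn (m.degree g) ≤ m.toSyn a)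
    (h : f.coeff a = g.coeff a) (h0 : f - g ≠ 0) : m.toSyn (m.degree (f - g)) < m.toSyn a := by
  refine lt_of_coeff_eq_zero (fun e he => ?_) h0
  rw [coeff_sub]
  rcases he.eq_or_lt with he | he
  · rw [← m.toSyn.injective he, h, sub_self]
  · rw [m.coeff_eq_zero_of_lt (hf.trans_lt he), m.coeff_eq_zero_of_lt (hg.trans_lt he), sub_zero]

theorem degree_monomial_mul_le (a : σ →₀ ℕ) (c : K) (g : MvPolynomial σ K) :
    m.toSyn (m.degree (monomial a c * g)) ≤ m.toSyn (a + m.degree g) := by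
  refine m.degree_mul_le.trans ?_
  rw [map_add, map_add]
  exact add_le_add_left (m.degree_monomial_le _) _

/-- Both multiples have coefficient 1 at the least common multiple, and these cancel. -/
theorem degree_monicSPolynomial_lt {f g : MvPolynomial σ K} (hf : f ≠ 0) (hg : g ≠ 0)
    (h : m.monicSPolynomial f g ≠ 0) :
    m.toSyn (m.degree (m.monicSPolynomial f g)) < m.toSyn (m.degree f ⊔ m.degree g) := by
  have h1 : m.degree f ⊔ m.degree g - m.degree f + m.degree f = m.degree f ⊔ m.degree g :=
    tsub_add_cancel_of_le le_sup_left
  have h2 : m.degree f ⊔ m.degree g - m.degree g + m.degree g = m.degree f ⊔ m.degree g :=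
    tsub_add_cancel_of_le le_sup_right
  have hf' := m.leadingCoeff_ne_zero_iff.2 hf
  have hg' := m.leadingCoeff_ne_zero_iff.2 hg
  refine degree_sub_lt_of_coeff_eq ?_ ?_ ?_ h
  · exact (degree_monomial_mul_le _ _ _).trans_eq (by rw [h1])
  · exact (degree_monomial_mul_le _ _ _).trans_eq (by rw [h2])
  · have h3 := coeff_add_degree_monomial_mul (m := m) (m.degree f ⊔ m.degree g - m.degree f)
      (m.leadingCoeff f)⁻¹ f
    have h4 := coeff_add_degree_monomial_mul (m := m) (m.degree f ⊔ m.degree g - m.degree g)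
      (m.leadingCoeff g)⁻¹ g
    rw [h1, inv_mul_cancel₀ hf'] at h3
    rw [h2, inv_mul_cancel₀ hg'] at h4
    rw [h3, h4]

/-- The heart of Buchberger's criterion. Two multiples of generators with the same leading exponent
differ, after scaling, by a multiple of an S-polynomial, which has a representation strictly below.
So a single multiple `X^a₀ g₀` accounts for the whole top level of a representation. -/
theorem sub_smul_mem_repSpan_of_monicSPolynomial (h0 : 0 ∉ G)
    (hS : ∀ f ∈ G, ∀ g ∈ G,
      m.monicSPolynomial f g ∈ m.repSpan G (Set.Iio (m.toSyn (m.degree f ⊔ m.degree g))))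
    {g₀ : MvPolynomial σ K} (hg₀ : g₀ ∈ G) (a₀ : σ →₀ ℕ) {x : MvPolynomial σ K}
    (hx : x ∈ m.repSpan G (Set.Iic (m.toSyn (a₀ + m.degree g₀)))) :
    x - (x.coeff (a₀ + m.degree g₀) / m.leadingCoeff g₀) • (monomial a₀ 1 * g₀) ∈
      m.repSpan G (Set.Iio (m.toSyn (a₀ + m.degree g₀))) := by
  have hl : ∀ g ∈ G, m.leadingCoeff g ≠ 0 := fun g hg =>
    m.leadingCoeff_ne_zero_iff.2 fun h => h0 (h ▸ hg)
  induction hx using Submodule.span_induction with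
  | mem x hx =>
    obtain ⟨g, hg, a, ha, rfl⟩ := hx
    rcases (Set.mem_Iic.1 ha).eq_or_lt with ha | ha
    · have ha := m.toSyn.injective ha
      rw [← ha, coeff_add_degree_monomial_mul, one_mul]
      -- The common leading exponent is divisible by both leading exponents, hence by their least
      -- common multiple; `b` is the cofactor.
      obtain ⟨b, hb⟩ : ∃ b, a + m.degree g = b + (m.degree g ⊔ m.degree g₀) :=
        ⟨_, (tsub_add_cancel_of_le (sup_le le_add_self (ha ▸ le_add_self))).symm⟩
      have h1 : b + (m.degree g ⊔ m.degree g₀ - m.degree g) = a := by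
        have h : m.degree g ⊔ m.degree g₀ - m.degree g + m.degree g = m.degree g ⊔ m.degree g₀ :=
          tsub_add_cancel_of_le le_sup_left
        rw [← h, ← add_assoc] at hb
        exact (add_right_cancel hb).symm
      have h2 : b + (m.degree g ⊔ m.degree g₀ - m.degree g₀) = a₀ := by
        have h : m.degree g ⊔ m.degree g₀ - m.degree g₀ + m.degree g₀ = m.degree g ⊔ m.degree g₀ :=
          tsub_add_cancel_of_le le_sup_right
        rw [ha, ← h, ← add_assoc] at hb
        exact (add_right_cancel hb).symm
      have key : monomial a 1 * g - (m.leadingCoeff g / m.leadingCoeff g₀) • (monomial a₀ 1 * g₀) =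
          monomial b (m.leadingCoeff g) * m.monicSPolynomial g g₀ := by
        rw [monicSPolynomial, mul_sub, ← mul_assoc, ← mul_assoc, monomial_mul, monomial_mul, h1, h2,
          mul_inv_cancel₀ (hl g hg), ← smul_mul_assoc, smul_monomial, smul_eq_mul, mul_one,
          div_eq_mul_inv]
      rw [key]
      refine mul_mem_repSpan (fun s hs => ?_) _ (hS g hg g₀ hg₀)
      rw [hb, map_add]
      exact add_lt_add_right hs _
    · rw [m.coeff_eq_zero_of_lt ((degree_monomial_mul_le _ _ _).trans_lt ha), zero_div, zero_smul,
        sub_zero]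
      exact monomial_mul_mem_repSpan hg ha _
  | zero => simp
  | add x y _ _ hx hy =>
    rw [coeff_add, add_div, add_smul, add_sub_add_comm]
    exact add_mem hx hy
  | smul r x _ hx =>
    rw [coeff_smul, smul_eq_mul, mul_div_assoc, mul_smul, ← smul_sub]
    exact Submodule.smul_mem _ _ hx

/-- Buchberger's criterion. -/
theorem exists_degree_le_of_monicSPolynomial (h0 : 0 ∉ G)
    (hS : ∀ f ∈ G, ∀ g ∈ G,
      m.monicSPolynomial f g ∈ m.repSpan G (Set.Iio (m.toSyn (m.degree f ⊔ m.degree g))))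
    {x : MvPolynomial σ K} (hx : x ∈ Ideal.span G) (hx0 : x ≠ 0) :
    ∃ g ∈ G, m.degree g ≤ m.degree x := by
  obtain ⟨d, -, hd⟩ := exists_mem_repSpan_Iic (mem_repSpan_univ (m := m) hx) hx0
  clear hx
  -- The bound `d` on a representation of `x` is lowered until `x` has a nonzero coefficient there.
  -- Then `d` is the degree of `x` and is visibly divisible by a leading exponent.
  induction d using WellFoundedLT.induction generalizing x with
  | ind d ih =>
    have ih' : x ∈ m.repSpan G (Set.Iio d) → ∃ g ∈ G, m.degree g ≤ m.degree x := fun hx => by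
      obtain ⟨e, he, hxe⟩ := exists_mem_repSpan_Iic hx hx0
      exact ih e he hx0 hxe
    by_cases htop : ∃ g ∈ G, ∃ a, m.toSyn (a + m.degree g) = d
    · obtain ⟨g, hg, a, rfl⟩ := htop
      by_cases hc : x.coeff (a + m.degree g) = 0
      · apply ih'
        simpa [hc] using sub_smul_mem_repSpan_of_monicSPolynomial h0 hS hg a hd
      · refine ⟨g, hg, ?_⟩
        have : m.degree x = a + m.degree g := by
          apply m.toSyn.injective
          refine le_antisymm ?_ (m.le_degree (mem_support_iff.2 hc))
          by_contra hlt
          exact m.coeff_degree_ne_zero_iff.2 hx0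
            (coeff_eq_zero_of_mem_repSpan (fun s hs => (Set.mem_Iic.1 hs).trans_lt (not_le.1 hlt)) hd)
        rw [this]
        exact le_add_self
    · refine ih' (Submodule.span_mono ?_ hd)
      rintro _ ⟨g, hg, a, ha, rfl⟩
      exact ⟨g, hg, a, lt_of_le_of_ne ha fun h => htop ⟨g, hg, a, h⟩, rfl⟩

end Representations

end MonomialOrder

/-! ### Division with remainder and Buchberger's algorithm -/

section Reduced

open MvPolynomial

variable {σ K : Type*} [Field K]

/-- The polynomials none of whose monomials is divisible by a leading monomial of an element
of `G`. -/
def MonomialOrder.reduced (m : MonomialOrder σ) (G : Set (MvPolynomial σ K)) :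
    Submodule K (MvPolynomial σ K) where
  carrier := {x | ∀ s, x.coeff s ≠ 0 → ∀ g ∈ G, g ≠ 0 → ¬ m.degree g ≤ s}
  zero_mem' := by simp
  add_mem' {x y} hx hy s hs := by
    by_cases h : x.coeff s = 0
    · exact hy s (by simpa [h] using hs)
    · exact hx s h
  smul_mem' r x hx s hs := hx s fun h => hs (by simp [h])

theorem MonomialOrder.monomial_mem_reduced {m : MonomialOrder σ} {G : Set (MvPolynomial σ K)}
    {s : σ →₀ ℕ} (hs : ∀ g ∈ G, g ≠ 0 → ¬ m.degree g ≤ s) (c : K) :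
    monomial s c ∈ m.reduced G := by
  classical
  intro t ht
  rw [coeff_monomial] at ht
  split_ifs at ht with h
  · exact h ▸ hs
  · exact absurd rfl ht

end Reduced

namespace WeilAlg

open SPoly MonomialOrder

variable {n : ℕ} {K : Type} [Field K]

/-- The polynomials represented by the entries of a list. -/
def mvSet (G : List (SPoly n K)) : Set (MvPolynomial (Fin n) K) := {f | ∃ p ∈ G, f = toMv p}

theorem toMv_mem_mvSet {G : List (SPoly n K)} {g : SPoly n K} (hg : g ∈ G) : toMv g ∈ mvSet G :=
  ⟨g, hg, rfl⟩

theorem mvSet_cons (r : SPoly n K) (G : List (SPoly n K)) :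
    mvSet (r :: G) = insert (toMv r) (mvSet G) := by
  ext f; simp [mvSet]

theorem idealOf_eq (G : List (SPoly n K)) : idealOf G = Ideal.span (mvSet G) := rfl

open scoped Classical in
/-- The leading exponent, or `⊥` for the zero polynomial. -/
noncomputable def degreeBot (m : MonomialOrder (Fin n)) (p : SPoly n K) : WithBot m.syn :=
  if toMv p = 0 then ⊥ else (m.toSyn (m.degree (toMv p)) : WithBot m.syn)

theorem degreeBot_lt {m : MonomialOrder (Fin n)} {p q : SPoly n K} (hp : toMv p ≠ 0)
    (h : toMv q ≠ 0 → m.toSyn (m.degree (toMv q)) < m.toSyn (m.degree (toMv p))) :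
    degreeBot m q < degreeBot m p := by
  rw [degreeBot, degreeBot, if_neg hp]
  split_ifs with hq
  · exact WithBot.bot_lt_coe _
  · exact WithBot.coe_lt_coe.2 (h hq)

theorem mem_of_mem_pairs {α : Type} {l : List α} {x : α × α} (h : x ∈ pairs l) :
    x.1 ∈ l ∧ x.2 ∈ l := by
  induction l with
  | nil => simp [pairs] at h
  | cons a l ih =>
    rw [pairs, List.mem_append, List.mem_map] at h
    rcases h with ⟨y, hy, rfl⟩ | h
    · simp [hy]
    · exact (ih h).imp (List.mem_cons_of_mem _) (List.mem_cons_of_mem _)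

theorem mem_pairs_or {α : Type} {l : List α} {a b : α} (ha : a ∈ l) (hb : b ∈ l) :
    a = b ∨ (a, b) ∈ pairs l ∨ (b, a) ∈ pairs l := by
  induction l with
  | nil => simp at ha
  | cons c l ih =>
    simp only [pairs, List.mem_append, List.mem_map, Prod.mk.injEq]
    rcases List.mem_cons.1 ha with rfl | ha' <;> rcases List.mem_cons.1 hb with rfl | hb'
    · exact Or.inl rfl
    · exact Or.inr (Or.inl (Or.inl ⟨b, hb', rfl, rfl⟩))
    · exact Or.inr (Or.inr (Or.inl ⟨a, ha', rfl, rfl⟩))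
    · exact (ih ha' hb').imp_right (Or.imp Or.inr Or.inr)

/-- The ideal of the leading monomials. -/
noncomputable def leadIdeal (m : MonomialOrder (Fin n)) (G : List (SPoly n K)) :
    Ideal (MvPolynomial (Fin n) K) :=
  Ideal.span ((fun s => MvPolynomial.monomial s (1 : K)) '' (m.degree '' mvSet G))

/-- A monomial lies in a monomial ideal only if a generator divides it, and no old leading monomial
divides the leading monomial of a reduced polynomial. -/
theorem leadIdeal_lt_cons {m : MonomialOrder (Fin n)} {G : List (SPoly n K)} {r : SPoly n K}
    (hG : ∀ g ∈ G, toMv g ≠ 0) (hr : toMv r ∈ m.reduced (mvSet G)) (hr0 : toMv r ≠ 0) :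
    leadIdeal m G < leadIdeal m (r :: G) := by
  have hle : leadIdeal m G ≤ leadIdeal m (r :: G) := by
    apply Ideal.span_mono
    rw [mvSet_cons]
    exact Set.image_mono (Set.image_mono (Set.subset_insert _ _))
  refine lt_of_le_of_ne hle fun h => ?_
  have h1 : MvPolynomial.monomial (m.degree (toMv r)) (1 : K) ∈ leadIdeal m (r :: G) := by
    refine Ideal.subset_span ⟨_, ⟨toMv r, ?_, rfl⟩, rfl⟩
    rw [mvSet_cons]
    exact Set.mem_insert _ _
  rw [← h, leadIdeal, MvPolynomial.mem_ideal_span_monomial_image] at h1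
  obtain ⟨_, ⟨_, ⟨g, hg, rfl⟩, rfl⟩, hle⟩ := h1 (m.degree (toMv r)) (by simp)
  exact hr _ (m.coeff_degree_ne_zero_iff.2 hr0) _ (toMv_mem_mvSet hg) (hG g hg) hle

/-- The invariant of Buchberger's algorithm. -/
structure BuchbergerInv (m : MonomialOrder (Fin n)) (I : Ideal (MvPolynomial (Fin n) K))
    (s : List (SPoly n K) × List (SPoly n K × SPoly n K)) : Prop where
  ideal : idealOf s.1 = I
  ne_zero : ∀ g ∈ s.1, toMv g ≠ 0
  mem_of_mem : ∀ x ∈ s.2, x.1 ∈ s.1 ∧ x.2 ∈ s.1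
  treated : ∀ f ∈ s.1, ∀ g ∈ s.1,
    m.monicSPolynomial (toMv f) (toMv g) ∈
      m.repSpan (mvSet s.1) (Set.Iio (m.toSyn (m.degree (toMv f) ⊔ m.degree (toMv g)))) ∨
    (f, g) ∈ s.2 ∨ (g, f) ∈ s.2

/-- Only one order of each pair is stored. The other order is settled too, because exchanging `f`
and `g` changes only the sign of the S-polynomial. -/
theorem BuchbergerInv.drop {m : MonomialOrder (Fin n)} {I : Ideal (MvPolynomial (Fin n) K)}
    {G : List (SPoly n K)} {P P' : List (SPoly n K × SPoly n K)} {f g : SPoly n K}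
    (h : BuchbergerInv m I (G, P')) (hP : P ⊆ P') (hP' : ∀ x ∈ P', x = (f, g) ∨ x ∈ P)
    (hfg : m.monicSPolynomial (toMv f) (toMv g) ∈
      m.repSpan (mvSet G) (Set.Iio (m.toSyn (m.degree (toMv f) ⊔ m.degree (toMv g))))) :
    BuchbergerInv m I (G, P) := by
  refine ⟨h.ideal, h.ne_zero, fun x hx => h.mem_of_mem x (hP hx), ?_⟩
  intro f' hf' g' hg'
  rcases h.treated f' hf' g' hg' with h1 | h1 | h1
  · exact Or.inl h1
  · rcases hP' _ h1 with h1 | h1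
    · cases h1; exact Or.inl hfg
    · exact Or.inr (Or.inl h1)
  · rcases hP' _ h1 with h1 | h1
    · cases h1
      rw [monicSPolynomial_swap, neg_mem_iff, sup_comm]
      exact Or.inl hfg
    · exact Or.inr (Or.inr h1)

/-- Representations over `G` survive its enlargement, so only the pairs with the new element are
added. -/
theorem BuchbergerInv.cons {m : MonomialOrder (Fin n)} {I : Ideal (MvPolynomial (Fin n) K)}
    {G : List (SPoly n K)} {P : List (SPoly n K × SPoly n K)}
    (h : BuchbergerInv m I (G, P)) {r : SPoly n K} (hr : toMv r ∈ I) (hr0 : toMv r ≠ 0) :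
    BuchbergerInv m I (r :: G, G.map (fun x => (r, x)) ++ P) := by
  refine ⟨?_, ?_, ?_, ?_⟩
  · have hI := h.ideal
    simp only [idealOf_eq] at hI ⊢
    rw [mvSet_cons, Ideal.span_insert, hI, sup_eq_right, Ideal.span_singleton_le_iff_mem]
    exact hr
  · rintro g hg
    rcases List.mem_cons.1 hg with rfl | hg
    · exact hr0
    · exact h.ne_zero g hg
  · intro x hx
    rcases List.mem_append.1 hx with hx | hx
    · obtain ⟨y, hy, rfl⟩ := List.mem_map.1 hx
      exact ⟨List.mem_cons_self, List.mem_cons_of_mem _ hy⟩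
    · exact (h.mem_of_mem x hx).imp (List.mem_cons_of_mem _) (List.mem_cons_of_mem _)
  · intro f hf g hg
    rcases List.mem_cons.1 hf with rfl | hf' <;> rcases List.mem_cons.1 hg with rfl | hg'
    · rw [monicSPolynomial_self]
      exact Or.inl (zero_mem _)
    · exact Or.inr (Or.inl (List.mem_append_left _ (List.mem_map.2 ⟨g, hg', rfl⟩)))
    · exact Or.inr (Or.inr (List.mem_append_left _ (List.mem_map.2 ⟨f, hf', rfl⟩)))
    · refine (h.treated f hf' g hg').imp (fun h1 => ?_)
        (Or.imp (List.mem_append_right _) (List.mem_append_right _))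
      refine repSpan_mono ?_ subset_rfl h1
      rw [mvSet_cons]
      exact Set.subset_insert _ _

/-- `G` is a Gröbner basis of `I` without zero entries. -/
structure IsGroebner (m : MonomialOrder (Fin n)) (I : Ideal (MvPolynomial (Fin n) K))
    (G : List (SPoly n K)) : Prop where
  ideal : idealOf G = I
  ne_zero : ∀ g ∈ G, toMv g ≠ 0
  exists_degree_le : ∀ x ∈ I, x ≠ 0 → ∃ g ∈ G, m.degree (toMv g) ≤ m.degree x

variable [DecidableEq K]

theorem forall_lmDivides_eq_false {m : MonomialOrder (Fin n)} {G : List (SPoly n K)}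
    {a : Fin n → ℕ} :
    (∀ g ∈ G, lmDivides m.test a g = false) ↔
      ∀ g ∈ mvSet G, g ≠ 0 → ¬ m.degree g ≤ expo a := by
  simp only [mvSet, Set.mem_ofPred_eq, forall_exists_index, and_imp, ← Bool.not_eq_true,
    lmDivides_iff, not_and]
  constructor
  · rintro h _ g hg rfl
    exact h g hg
  · exact fun h g hg => h _ g hg rfl

theorem exists_mem_rem (m : MonomialOrder (Fin n)) (G : List (SPoly n K)) (p : SPoly n K) :
    ∃ r ∈ rem m.test G p,
      toMv p - toMv r ∈ m.repSpan (mvSet G) (Set.Iic (m.toSyn (m.degree (toMv p)))) ∧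
      toMv r ∈ m.reduced (mvSet G) := by
  -- The measure puts 0 below the nonzero constants, so cancelling a last constant term counts as
  -- progress. The second clause of the invariant keeps every subtracted multiple within the degree
  -- of `p`; Buchberger's criterion needs this bound besides the congruence.
  refine PFun.exists_mem_fix (fun s => degreeBot m s.1)
    (P := fun s => toMv p - toMv s.1 - toMv s.2 ∈
        m.repSpan (mvSet G) (Set.Iic (m.toSyn (m.degree (toMv p)))) ∧
      (toMv s.1 ≠ 0 → m.toSyn (m.degree (toMv s.1)) ≤ m.toSyn (m.degree (toMv p))) ∧
      toMv s.2 ∈ m.reduced (mvSet G)) ?_ (p, []) (by simp)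
  rintro ⟨q, r⟩ ⟨h1, h2, h3⟩
  dsimp only at h1 h2 h3 ⊢
  simp only [remStep]
  rcases hq : lm m.test q with _ | a
  · refine Or.inl ⟨r, by simp, ?_, h3⟩
    rwa [lm_eq_none.1 hq, sub_zero] at h1
  obtain ⟨hq0, hqa⟩ := lm_eq_some.1 hq
  have hc := coeff_eq_leadingCoeff hq
  right
  rcases hf : G.find? (lmDivides m.test a) with _ | g
  · simp only [hf]
    refine ⟨_, Part.mem_some _, ?_⟩
    dsimp only
    have hred : ∀ g ∈ mvSet G, g ≠ 0 → ¬ m.degree g ≤ expo a := by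
      rw [← forall_lmDivides_eq_false]
      simpa using hf
    have e : toMv (subMul q a (coeff q a) [(0, 1)]) =
        toMv q - MvPolynomial.monomial (expo a) (coeff q a) := by
      simp [toMv_subMul]
    have hlt : toMv (subMul q a (coeff q a) [(0, 1)]) ≠ 0 →
        m.toSyn (m.degree (toMv (subMul q a (coeff q a) [(0, 1)]))) <
          m.toSyn (m.degree (toMv q)) := by
      rw [e, hqa]
      refine degree_sub_lt_of_coeff_eq (by rw [hqa]) (m.degree_monomial_le _) ?_
      rw [coeff_toMv, MvPolynomial.coeff_monomial, if_pos rfl]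
    refine ⟨⟨?_, fun h => (hlt h).le.trans (h2 hq0), ?_⟩, degreeBot_lt hq0 hlt⟩
    · rw [e, toMv_cons]
      convert h1 using 1
      ring
    · rw [toMv_cons]
      exact add_mem (monomial_mem_reduced hred _) h3
  · have hg := List.mem_of_find?_eq_some hf
    obtain ⟨hg0, hdiv⟩ := lmDivides_iff.1 (List.find?_some hf)
    rcases hgb : lm m.test g with _ | b
    · exact absurd (lm_eq_none.1 hgb) hg0
    simp only [hf, hgb]
    refine ⟨_, Part.mem_some _, ?_⟩
    have hgd := (lm_eq_some.1 hgb).2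
    have hgc := coeff_eq_leadingCoeff hgb
    have hab : expo (a - b) + m.degree (toMv g) = expo a := by
      rw [expo_sub, ← hgd]; exact tsub_add_cancel_of_le hdiv
    dsimp only
    have e := toMv_subMul q (a - b) (coeff q a / coeff g b) g
    have hlt : toMv (subMul q (a - b) (coeff q a / coeff g b) g) ≠ 0 →
        m.toSyn (m.degree (toMv (subMul q (a - b) (coeff q a / coeff g b) g))) <
          m.toSyn (m.degree (toMv q)) := by
      rw [e, hqa]
      refine degree_sub_lt_of_coeff_eq (by rw [hqa])
        ((degree_monomial_mul_le _ _ _).trans_eq (by rw [hab])) ?_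
      have h4 := coeff_add_degree_monomial_mul (m := m) (expo (a - b)) (coeff q a / coeff g b)
        (toMv g)
      rw [hab, ← hgc, div_mul_cancel₀] at h4
      · rw [h4, coeff_toMv]
      · rw [hgc]; exact m.leadingCoeff_ne_zero_iff.2 hg0
    refine ⟨⟨?_, fun h => (hlt h).le.trans (h2 hq0), h3⟩, degreeBot_lt hq0 hlt⟩
    rw [e]
    have h5 : MvPolynomial.monomial (expo (a - b)) (coeff q a / coeff g b) * toMv g ∈
        m.repSpan (mvSet G) (Set.Iic (m.toSyn (m.degree (toMv p)))) := by
      refine monomial_mul_mem_repSpan (toMv_mem_mvSet hg) ?_ _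
      rw [hab, ← hqa]
      exact h2 hq0
    convert add_mem h1 h5 using 1
    ring

theorem toMv_sPoly {m : MonomialOrder (Fin n)} {f g : SPoly n K} (hf : toMv f ≠ 0)
    (hg : toMv g ≠ 0) : toMv (sPoly m.test f g) = m.monicSPolynomial (toMv f) (toMv g) := by
  rcases ha : lm m.test f with _ | a
  · exact absurd (lm_eq_none.1 ha) hf
  rcases hb : lm m.test g with _ | b
  · exact absurd (lm_eq_none.1 hb) hg
  simp only [sPoly, ha, hb]
  rw [toMv_subMul, toMv_mulTerm, monicSPolynomial, (lm_eq_some.1 ha).2, (lm_eq_some.1 hb).2,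
    coeff_eq_leadingCoeff ha, coeff_eq_leadingCoeff hb, expo_sub, expo_sub, expo_sup]

theorem BuchbergerInv.init (m : MonomialOrder (Fin n)) (F : List (SPoly n K)) :
    BuchbergerInv m (idealOf F)
      (F.filter (fun f => supp f ≠ []), pairs (F.filter fun f => supp f ≠ [])) := by
  refine ⟨?_, ?_, fun x hx => mem_of_mem_pairs hx, ?_⟩
  · apply le_antisymm
    · refine Ideal.span_mono ?_
      rintro _ ⟨g, hg, rfl⟩
      exact ⟨g, (List.mem_filter.1 hg).1, rfl⟩
    · refine Ideal.span_le.2 ?_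
      rintro _ ⟨g, hg, rfl⟩
      by_cases h0 : toMv g = 0
      · rw [h0]; exact zero_mem _
      · exact Ideal.subset_span ⟨g, List.mem_filter.2 ⟨hg, by simpa [supp_eq_nil] using h0⟩, rfl⟩
  · intro g hg
    simpa [supp_eq_nil] using (List.mem_filter.1 hg).2
  · intro f hf g hg
    rcases mem_pairs_or hf hg with rfl | h
    · rw [monicSPolynomial_self]
      exact Or.inl (zero_mem _)
    · exact Or.inr h

theorem exists_mem_calcGroebnerBasis (m : MonomialOrder (Fin n)) (F : List (SPoly n K)) :
    ∃ G ∈ calcGroebnerBasis m.test F, IsGroebner m (idealOf F) G := by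
  refine PFun.exists_mem_fix
    -- Lexicographic measure: the leading ideal grows strictly, which is well-founded in the dual
    -- order by noetherianity, or the basis is unchanged and a pair disappears.
    (fun s => toLex (OrderDual.toDual (leadIdeal m s.1), s.2.length))
    (P := BuchbergerInv m (idealOf F)) ?_ _ (BuchbergerInv.init m F)
  rintro ⟨G, P⟩ h
  rcases P with _ | ⟨⟨f, g⟩, P⟩
  · refine Or.inl ⟨G, by simp [buchbergerStep], h.ideal, h.ne_zero, fun x hx hx0 => ?_⟩
    rw [← h.ideal] at hx
    have := exists_degree_le_of_monicSPolynomial (m := m) (G := mvSet G) ?_ ?_ hx hx0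
    · obtain ⟨_, ⟨g, hg, rfl⟩, hle⟩ := this
      exact ⟨g, hg, hle⟩
    · rintro ⟨g, hg, h0⟩
      exact h.ne_zero g hg h0.symm
    · rintro _ ⟨f, hf, rfl⟩ _ ⟨g, hg, rfl⟩
      simpa using h.treated f hf g hg
  right
  obtain ⟨hf, hg⟩ := h.mem_of_mem _ List.mem_cons_self
  have hf0 := h.ne_zero _ hf
  have hg0 := h.ne_zero _ hg
  obtain ⟨r, hr, hrep, hred⟩ := exists_mem_rem m G (sPoly m.test f g)
  rw [toMv_sPoly hf0 hg0] at hrep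
  -- A zero S-polynomial is set apart: its formal degree 0 need not lie strictly below the least
  -- common multiple.
  have hlt : m.monicSPolynomial (toMv f) (toMv g) ≠ 0 → Set.Iic (m.toSyn (m.degree
      (m.monicSPolynomial (toMv f) (toMv g)))) ⊆
        Set.Iio (m.toSyn (m.degree (toMv f) ⊔ m.degree (toMv g))) := fun h0 =>
    Set.Iic_subset_Iio.2 (degree_monicSPolynomial_lt hf0 hg0 h0)
  by_cases h0 : toMv r = 0
  · refine ⟨(G, P), ?_, h.drop (List.subset_cons_self _ _) (fun x hx => List.mem_cons.1 hx) ?_, ?_⟩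
    · rw [buchbergerStep, Part.mem_bind_iff]
      refine ⟨r, hr, ?_⟩
      rw [if_pos (supp_eq_nil.2 h0)]
      exact Part.mem_some _
    · by_cases hz : m.monicSPolynomial (toMv f) (toMv g) = 0
      · rw [hz]; exact zero_mem _
      · rw [h0, sub_zero] at hrep
        exact repSpan_mono subset_rfl (hlt hz) hrep
    · exact Prod.Lex.toLex_lt_toLex.2 (Or.inr ⟨rfl, by simp⟩)
  · have hrI : toMv r ∈ idealOf F := by
      have h1 := mem_span_of_mem_repSpan hrep
      have hS : m.monicSPolynomial (toMv f) (toMv g) ∈ Ideal.span (mvSet G) :=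
        monicSPolynomial_mem (Ideal.subset_span (toMv_mem_mvSet hf))
          (Ideal.subset_span (toMv_mem_mvSet hg))
      rw [← h.ideal, idealOf_eq]
      simpa using sub_mem hS h1
    refine ⟨(r :: G, G.map (fun x => (r, x)) ++ P), ?_, (h.cons hrI h0).drop (f := f) (g := g)
      ?_ ?_ ?_, ?_⟩
    · rw [buchbergerStep, Part.mem_bind_iff]
      refine ⟨r, hr, ?_⟩
      rw [if_neg (mt supp_eq_nil.1 h0)]
      exact Part.mem_some _
    · intro x hx
      simp only [List.mem_append, List.mem_cons] at hx ⊢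
      tauto
    · intro x hx
      simp only [List.mem_append, List.mem_cons] at hx ⊢
      tauto
    · by_cases hz : m.monicSPolynomial (toMv f) (toMv g) = 0
      · rw [hz]; exact zero_mem _
      -- Were the degree of `r` larger, its leading coefficient would survive in the difference,
      -- contrary to the degree bound of the representation.
      have hle : m.toSyn (m.degree (toMv r)) ≤
          m.toSyn (m.degree (m.monicSPolynomial (toMv f) (toMv g))) := by
        by_contra hlt
        have h1 := coeff_eq_zero_of_mem_repSpan
          (fun s hs => (Set.mem_Iic.1 hs).trans_lt (not_le.1 hlt)) hrep
        rw [MvPolynomial.coeff_sub, m.coeff_eq_zero_of_lt (not_le.1 hlt), zero_sub,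
          neg_eq_zero] at h1
        exact m.coeff_degree_ne_zero_iff.2 h0 h1
      have h1 := repSpan_mono (Set.subset_insert (toMv r) _) subset_rfl hrep
      -- Once `r` is a generator, it represents itself, and the S-polynomial is the sum of `r` and
      -- the represented difference.
      have h2 : toMv r ∈ m.repSpan (insert (toMv r) (mvSet G)) (Set.Iic (m.toSyn (m.degree
          (m.monicSPolynomial (toMv f) (toMv g))))) := by
        simpa using monomial_mul_mem_repSpan (Set.mem_insert (toMv r) _) (a := 0) (c := 1)
          (by simpa using hle)
      rw [mvSet_cons]
      refine repSpan_mono subset_rfl (hlt hz) ?_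
      simpa using add_mem h1 h2
    · exact Prod.Lex.toLex_lt_toLex.2
        (Or.inl (OrderDual.toDual_lt_toDual.2 (leadIdeal_lt_cons h.ne_zero hred h0)))

end WeilAlg

/-! ### Standard monomials and normal forms -/

namespace WeilAlg

open SPoly MonomialOrder

theorem mem_box {n : ℕ} {d a : Fin n → ℕ} : a ∈ box n d ↔ ∀ i, a i < d i := by
  induction n with
  | zero => simp [box, Subsingleton.elim a Fin.elim0]
  | succ n ih =>
    simp only [box, List.mem_flatMap, List.mem_range, List.mem_map, ih, Fin.forall_fin_succ]
    constructor
    · rintro ⟨b, hb, α, hα, rfl⟩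
      exact ⟨by simpa using hb, fun i => by simpa using hα i⟩
    · rintro ⟨h0, h1⟩
      exact ⟨a 0, h0, fun i => a i.succ, h1, Fin.cons_self_tail a⟩

theorem nodup_box {n : ℕ} (d : Fin n → ℕ) : (box n d).Nodup := by
  induction n with
  | zero => simp [box]
  | succ n ih =>
    rw [box, List.nodup_flatMap]
    refine ⟨fun b _ => (ih _).map (Fin.cons_right_injective (α := fun _ => ℕ) b), ?_⟩
    refine List.nodup_range.imp fun {b c} hbc => ?_
    simp only [Function.onFun, List.disjoint_left, List.mem_map]
    rintro _ ⟨α, -, rfl⟩ ⟨β, -, h⟩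
    exact hbc (by simpa using (congrFun h 0).symm)

variable {n : ℕ} {K : Type} [Field K]

theorem coeff_sum_monomial {B : List (Fin n → ℕ)} (hB : B.Nodup) (c : (Fin n → ℕ) → K)
    (a : Fin n → ℕ) : (B.map fun b => MvPolynomial.monomial (expo b) (c b)).sum.coeff (expo a) =
      if a ∈ B then c a else 0 := by
  induction B with
  | nil => simp
  | cons b B ih =>
    rw [List.map_cons, List.sum_cons, MvPolynomial.coeff_add, ih hB.of_cons,
      MvPolynomial.coeff_monomial]
    have := (List.nodup_cons.1 hB).1
    by_cases h : b = a
    · subst h; simp [this]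
    · simp [h, Ne.symm h]

theorem eq_sum_of_mem_reduced {m : MonomialOrder (Fin n)} {G : Set (MvPolynomial (Fin n) K)}
    {B : List (Fin n → ℕ)} (hB : B.Nodup)
    (hBG : ∀ a, a ∈ B ↔ ∀ g ∈ G, g ≠ 0 → ¬ m.degree g ≤ expo a)
    {x : MvPolynomial (Fin n) K} (hx : x ∈ m.reduced G) :
    x = (B.map fun b => MvPolynomial.monomial (expo b) (x.coeff (expo b))).sum := by
  ext s
  rw [← expo_coe s, coeff_sum_monomial hB fun b => x.coeff (expo b)]
  split_ifs with h
  · rfl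
  · by_contra h0
    exact h ((hBG _).2 (hx _ h0))

/-- The leading monomial of a nonzero element of `I` is divisible by one of `G`, which reducedness
forbids. -/
theorem IsGroebner.eq_zero_of_mem_reduced {m : MonomialOrder (Fin n)}
    {I : Ideal (MvPolynomial (Fin n) K)} {G : List (SPoly n K)} (hG : IsGroebner m I G)
    {x : MvPolynomial (Fin n) K} (hx : x ∈ I) (hr : x ∈ m.reduced (mvSet G)) : x = 0 := by
  by_contra h0
  obtain ⟨g, hg, hle⟩ := hG.exists_degree_le x hx h0
  exact hr _ (m.coeff_degree_ne_zero_iff.2 h0) _ (toMv_mem_mvSet hg) (hG.ne_zero g hg) hle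

variable [DecidableEq K]

theorem IsGroebner.exists_mem_rem {m : MonomialOrder (Fin n)}
    {I : Ideal (MvPolynomial (Fin n) K)} {G : List (SPoly n K)} (hG : IsGroebner m I G)
    (p : SPoly n K) :
    ∃ r ∈ rem m.test G p, toMv p - toMv r ∈ I ∧ toMv r ∈ m.reduced (mvSet G) := by
  obtain ⟨r, hr, h1, h2⟩ := WeilAlg.exists_mem_rem m G p
  refine ⟨r, hr, ?_, h2⟩
  rw [← hG.ideal]
  exact mem_span_of_mem_repSpan h1

theorem purePower?_eq_some {m : MonomialOrder (Fin n)} {G : List (SPoly n K)} {i : Fin n} {d : ℕ}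
    (h : purePower? m.test G i = some d) :
    ∃ g ∈ G, toMv g ≠ 0 ∧ m.degree (toMv g) = Finsupp.single i d := by
  obtain ⟨g, hg, h⟩ := List.exists_of_findSome?_eq_some h
  refine ⟨g, hg, ?_⟩
  split at h
  · cases h
  · rename_i a ha
    obtain ⟨h0, hd⟩ := lm_eq_some.1 ha
    split_ifs at h with hs
    cases h
    refine ⟨h0, ?_⟩
    rw [hd, ← expo_single, ← hs]

theorem isSome_purePower? {m : MonomialOrder (Fin n)} {G : List (SPoly n K)} {i : Fin n} {d : ℕ}
    {g : SPoly n K} (hg : g ∈ G) (h0 : toMv g ≠ 0) (h : m.degree (toMv g) = Finsupp.single i d) :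
    (purePower? m.test G i).isSome = true := by
  rw [purePower?, List.findSome?_isSome_iff]
  refine ⟨g, hg, ?_⟩
  rw [← expo_single] at h
  rw [lm_eq_some.2 ⟨h0, h⟩]
  simp

/-- The box loses no standard monomial: outside it, some pure power already divides. That power need
not be the smallest one, and the default 0 is never reached here. -/
theorem mem_monomialBasis {m : MonomialOrder (Fin n)} {G : List (SPoly n K)}
    (hz : zeroDimensional m.test G = true) (a : Fin n → ℕ) :
    a ∈ monomialBasis m.test G ↔ ∀ g ∈ mvSet G, g ≠ 0 → ¬ m.degree g ≤ expo a := by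
  rw [← forall_lmDivides_eq_false, monomialBasis, List.mem_filter, mem_box]
  simp only [Bool.not_eq_true', List.any_eq_false, Bool.not_eq_true, and_iff_right_iff_imp]
  intro h i
  simp only [zeroDimensional, decide_eq_true_eq] at hz
  obtain ⟨d, hd⟩ := Option.isSome_iff_exists.1 (hz i)
  obtain ⟨g, hg, h0, hdeg⟩ := purePower?_eq_some hd
  by_contra hlt
  have : lmDivides m.test a g = true := by
    rw [lmDivides_iff, hdeg]
    refine ⟨h0, Finsupp.single_le_iff.2 ?_⟩
    simpa [hd] using hlt
  rw [h g hg] at this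
  cases this

theorem nodup_monomialBasis (m : MonomialOrder (Fin n)) (G : List (SPoly n K)) :
    (monomialBasis m.test G).Nodup := (nodup_box _).filter _

/-- If a power of every variable lies in `I`, then every Gröbner basis of `I` passes the test for
zero-dimensionality. -/
theorem IsGroebner.zeroDimensional {m : MonomialOrder (Fin n)}
    {I : Ideal (MvPolynomial (Fin n) K)} {G : List (SPoly n K)} (hG : IsGroebner m I G)
    (h : ∀ i, ∃ d : ℕ, (MvPolynomial.X i : MvPolynomial (Fin n) K) ^ d ∈ I) :
    zeroDimensional m.test G = true := by
  simp only [WeilAlg.zeroDimensional, decide_eq_true_eq]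
  intro i
  obtain ⟨d, hd⟩ := h i
  rw [MvPolynomial.X_pow_eq_monomial] at hd
  obtain ⟨g, hg, hle⟩ := hG.exists_degree_le _ hd (by simp)
  rw [m.degree_monomial, if_neg one_ne_zero] at hle
  -- A divisor of `X_i^d` involves no other variable. Its exponent may be smaller than `d`, and is 0
  -- if the leading monomial is 1.
  refine isSome_purePower? hg (hG.ne_zero g hg) (d := m.degree (toMv g) i) ?_
  ext j
  rw [Finsupp.single_apply]
  split_ifs with hj
  · rw [hj]
  · have := hle j
    rw [Finsupp.single_apply, if_neg hj] at this
    omega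

end WeilAlg

/-! ### Coordinates and the monomial basis of the quotient -/

namespace WeilAlg

open SPoly MonomialOrder

theorem mk_monomial {n : ℕ} (I : Ideal (MvPolynomial (Fin n) ℝ)) (a : Fin n → ℕ) (c : ℝ) :
    Ideal.Quotient.mk I (MvPolynomial.monomial (expo a) c) = c • monomialClass I a := by
  rw [monomialClass, ← Ideal.Quotient.mkₐ_eq_mk ℝ, ← map_smul, MvPolynomial.smul_monomial,
    smul_eq_mul, mul_one]

theorem monomialClass_add {n : ℕ} (I : Ideal (MvPolynomial (Fin n) ℝ))
    (a b : Fin n → ℕ) :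
    monomialClass I (a + b) = monomialClass I a * monomialClass I b := by
  rw [monomialClass, monomialClass, monomialClass, ← map_mul, MvPolynomial.monomial_mul, expo_add,
    mul_one]

variable {n : ℕ} [DecidableEq ℝ] {m : MonomialOrder (Fin n)} {I : Ideal (MvPolynomial (Fin n) ℝ)}
  {G : List (SPoly n ℝ)}

theorem mk_eq_sum_of_mem_reduced (hz : zeroDimensional m.test G = true)
    {x : MvPolynomial (Fin n) ℝ} (hx : x ∈ m.reduced (mvSet G)) :
    Ideal.Quotient.mk I x = ((monomialBasis m.test G).map fun b =>
      x.coeff (expo b) • monomialClass I b).sum := by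
  conv_lhs => rw [eq_sum_of_mem_reduced (nodup_monomialBasis m G) (mem_monomialBasis hz) hx]
  rw [map_list_sum, List.map_map]
  congr 1
  exact List.map_congr_left fun b _ => mk_monomial I b _

theorem exists_mem_normalForm (hG : IsGroebner m I G) (hz : zeroDimensional m.test G = true)
    (a : Fin n → ℕ) : ∃ c ∈ normalForm m.test G (monomialBasis m.test G) a,
      IsCoords I (monomialBasis m.test G) c (monomialClass I a) := by
  obtain ⟨r, hr, h1, h2⟩ := hG.exists_mem_rem [(a, 1)]
  refine ⟨_, Part.mem_bind_iff.2 ⟨r, hr, Part.mem_some _⟩, by simp, ?_⟩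
  rw [List.zipWith_map_left, List.zipWith_self]
  have h3 : monomialClass I a = Ideal.Quotient.mk I (toMv r) := by
    rw [monomialClass, Ideal.Quotient.eq]
    simpa using h1
  rw [h3, mk_eq_sum_of_mem_reduced hz h2]
  simp only [coeff_toMv]

theorem exists_mem_multTable (hG : IsGroebner m I G) (hz : zeroDimensional m.test G = true) :
    ∃ M ∈ multTable m.test G (monomialBasis m.test G),
      (∀ a b, (∃ c, ((a, b), c) ∈ M) ↔ a ∈ monomialBasis m.test G ∧ b ∈ monomialBasis m.test G) ∧
      ∀ a b c, ((a, b), c) ∈ M →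
        IsCoords I (monomialBasis m.test G) c (monomialClass I a * monomialClass I b) := by
  obtain ⟨M, hM, hF⟩ := List.exists_mem_mapM_part
    (l := monomialBasis m.test G ×ˢ monomialBasis m.test G)
    (f := fun ab => (normalForm m.test G (monomialBasis m.test G) (ab.1 + ab.2)).bind
      fun c => Part.some (ab, c))
    (R := fun ab t => t.1 = ab ∧
      IsCoords I (monomialBasis m.test G) t.2 (monomialClass I ab.1 * monomialClass I ab.2))
    (by
      intro ab _
      obtain ⟨c, hc, h⟩ := exists_mem_normalForm hG hz (ab.1 + ab.2)
      rw [monomialClass_add] at h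
      exact ⟨(ab, c), Part.mem_bind_iff.2 ⟨c, hc, Part.mem_some _⟩, rfl, h⟩)
  refine ⟨M, hM, fun a b => ⟨?_, ?_⟩, ?_⟩
  · rintro ⟨c, hc⟩
    obtain ⟨ab, hab, h, -⟩ := List.Forall₂.exists_of_mem_right hF hc
    simpa [← h] using hab
  · rintro ⟨ha, hb⟩
    obtain ⟨⟨_, c⟩, ht, rfl, -⟩ := List.Forall₂.exists_of_mem_left hF
      (List.mem_product.2 ⟨ha, hb⟩)
    exact ⟨c, ht⟩
  · intro a b c hc
    obtain ⟨ab, -, rfl, h⟩ := List.Forall₂.exists_of_mem_right hF hc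
    exact h

theorem exists_mem_nonVanTable (hG : IsGroebner m I G) (hz : zeroDimensional m.test G = true)
    (k : Fin n → ℕ) : ∃ N ∈ nonVanTable m.test G (monomialBasis m.test G) k,
      (∀ a, (∃ c, (a, c) ∈ N) ↔ ∀ i, a i ≤ k i) ∧
      ∀ a c, (a, c) ∈ N → IsCoords I (monomialBasis m.test G) c (monomialClass I a) := by
  obtain ⟨N, hN, hF⟩ := List.exists_mem_mapM_part (l := box n fun i => k i + 1)
    (f := fun a => (normalForm m.test G (monomialBasis m.test G) a).bind
      fun c => Part.some (a, c))
    (R := fun a t => t.1 = a ∧ IsCoords I (monomialBasis m.test G) t.2 (monomialClass I a))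
    (by
      intro a _
      obtain ⟨c, hc, h⟩ := exists_mem_normalForm hG hz a
      exact ⟨(a, c), Part.mem_bind_iff.2 ⟨c, hc, Part.mem_some _⟩, rfl, h⟩)
  refine ⟨N, hN, fun a => ⟨?_, ?_⟩, ?_⟩
  · rintro ⟨c, hc⟩
    obtain ⟨b, hb, rfl, -⟩ := List.Forall₂.exists_of_mem_right hF hc
    exact fun i => Nat.lt_succ_iff.1 (mem_box.1 hb i)
  · intro ha
    obtain ⟨⟨_, c⟩, ht, rfl, -⟩ := List.Forall₂.exists_of_mem_left hF
      (mem_box.2 fun i => Nat.lt_succ_iff.2 (ha i))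
    exact ⟨c, ht⟩
  · intro a c hc
    obtain ⟨b, -, rfl, h⟩ := List.Forall₂.exists_of_mem_right hF hc
    exact h

/-- A linear relation among the classes lifts to a reduced element of `I`, which is 0. -/
theorem linearIndependent_monomialClass (hG : IsGroebner m I G)
    (hz : zeroDimensional m.test G = true) :
    LinearIndependent ℝ fun j : Fin (monomialBasis m.test G).length =>
      monomialClass I ((monomialBasis m.test G).get j) := by
  rw [Fintype.linearIndependent_iff]
  intro c hc
  have h1 : ∑ j, MvPolynomial.monomial (expo ((monomialBasis m.test G).get j)) (c j) = 0 := by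
    refine hG.eq_zero_of_mem_reduced ?_ (sum_mem fun j _ => monomial_mem_reduced
      ((mem_monomialBasis hz _).1 (List.get_mem _ j)) _)
    rw [← Ideal.Quotient.eq_zero_iff_mem, map_sum, ← hc]
    exact Finset.sum_congr rfl fun j _ => mk_monomial _ _ _
  intro j
  have h2 := congrArg (MvPolynomial.coeff (expo ((monomialBasis m.test G).get j))) h1
  rw [MvPolynomial.coeff_sum, MvPolynomial.coeff_zero, Finset.sum_eq_single j] at h2
  · simpa using h2
  · intro i _ hij
    rw [MvPolynomial.coeff_monomial, if_neg]
    rw [expo_inj]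
    exact fun h => hij ((List.nodup_iff_injective_get.1 (nodup_monomialBasis m G)) h)
  · simp

theorem span_monomialClass_eq_top (hG : IsGroebner m I G)
    (hz : zeroDimensional m.test G = true) :
    Submodule.span ℝ (Set.range fun j : Fin (monomialBasis m.test G).length =>
      monomialClass I ((monomialBasis m.test G).get j)) = ⊤ := by
  rw [eq_top_iff]
  rintro w -
  obtain ⟨x, rfl⟩ := Ideal.Quotient.mk_surjective w
  obtain ⟨p, rfl⟩ := exists_toMv_eq x
  obtain ⟨r, -, h1, h2⟩ := hG.exists_mem_rem p
  rw [Ideal.Quotient.eq.2 h1, mk_eq_sum_of_mem_reduced hz h2]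
  refine list_sum_mem fun y hy => ?_
  obtain ⟨b, hb, rfl⟩ := List.mem_map.1 hy
  obtain ⟨j, rfl⟩ := List.mem_iff_get.1 hb
  exact Submodule.smul_mem _ _ (Submodule.subset_span ⟨j, rfl⟩)

end WeilAlg

/-! ### Monic generators of elimination ideals -/

namespace WeilAlg

open SPoly MonomialOrder Polynomial

variable {n : ℕ} {K : Type} [Field K] [DecidableEq K]

theorem exists_toMv_eliminate (m : OrderTest n) (v e : SPoly n K × SPoly n K) :
    ∃ c : K, toMv (eliminate m v e).1 = toMv v.1 - c • toMv e.1 ∧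
      toMv (eliminate m v e).2 = toMv v.2 - c • toMv e.2 := by
  rw [eliminate]
  split
  · exact ⟨0, by simp, by simp⟩
  · exact ⟨_, by rw [toMv_subMul, expo_zero, ← MvPolynomial.C_apply, MvPolynomial.C_mul'],
      by rw [toMv_subMul, expo_zero, ← MvPolynomial.C_apply, MvPolynomial.C_mul']⟩

theorem coeff_eliminate_eq_zero {m : MonomialOrder (Fin n)} {v e : SPoly n K × SPoly n K}
    {a : Fin n → ℕ} (ha : lm m.test e.1 = some a) : coeff (eliminate m.test v e).1 a = 0 := by
  have h0 : coeff e.1 a ≠ 0 := by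
    rw [coeff_eq_leadingCoeff ha]
    exact m.leadingCoeff_ne_zero_iff.2 (lm_eq_some.1 ha).1
  simp only [eliminate, ha]
  rw [← coeff_toMv, toMv_subMul, expo_zero, ← MvPolynomial.C_apply, MvPolynomial.coeff_sub,
    MvPolynomial.coeff_C_mul, coeff_toMv, coeff_toMv, div_mul_cancel₀ _ h0, sub_self]

/-- `x` has coefficient zero at the leading exponents of the rows in `L`. -/
def VanishesAtPivots (m : OrderTest n) (L : List (SPoly n K × SPoly n K))
    (x : MvPolynomial (Fin n) K) : Prop :=
  ∀ e ∈ L, ∀ a, lm m e.1 = some a → x.coeff (expo a) = 0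

/-- Applied to the rows after a pivot: they vanish there, so they cannot spoil a zero already
produced. -/
theorem coeff_foldl_eliminate {m : OrderTest n} {L : List (SPoly n K × SPoly n K)}
    {a : Fin n → ℕ} (hL : ∀ e ∈ L, coeff e.1 a = 0) (v : SPoly n K × SPoly n K) :
    coeff (L.foldl (eliminate m) v).1 a = coeff v.1 a := by
  induction L generalizing v with
  | nil => rfl
  | cons e L ih =>
    rw [List.foldl_cons, ih fun e he => hL e (List.mem_cons_of_mem _ he)]
    obtain ⟨c, hc, -⟩ := exists_toMv_eliminate m v e
    rw [← coeff_toMv, hc, MvPolynomial.coeff_sub, MvPolynomial.coeff_smul, coeff_toMv, coeff_toMv,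
      hL e List.mem_cons_self, smul_zero, sub_zero]

theorem vanishesAtPivots_foldl_eliminate {m : MonomialOrder (Fin n)}
    {L : List (SPoly n K × SPoly n K)}
    (hL : L.Pairwise fun e e' => ∀ a, lm m.test e.1 = some a → coeff e'.1 a = 0)
    (v : SPoly n K × SPoly n K) :
    VanishesAtPivots m.test L (toMv (L.foldl (eliminate m.test) v).1) := by
  induction L generalizing v with
  | nil => simp [VanishesAtPivots]
  | cons e L ih =>
    obtain ⟨h1, h2⟩ := List.pairwise_cons.1 hL
    intro e' he' a ha
    rcases List.mem_cons.1 he' with rfl | he'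
    · rw [List.foldl_cons, coeff_toMv, coeff_foldl_eliminate fun e he => h1 e he a ha]
      exact coeff_eliminate_eq_zero ha
    · exact ih h2 _ e' he' a ha

/-- The row `e` consists of a polynomial of degree less than `j` in `X_i` and of a reduced
representative of it modulo `I`. -/
structure IsRow (m : MonomialOrder (Fin n)) (I : Ideal (MvPolynomial (Fin n) K))
    (G : List (SPoly n K)) (i : Fin n) (j : ℕ) (e : SPoly n K × SPoly n K) : Prop where
  reduced : toMv e.1 ∈ m.reduced (mvSet G)
  sub_mem : toMv e.2 - toMv e.1 ∈ I
  exists_aeval : ∃ P : K[X], P.degree < j ∧ toMv e.2 = aeval (MvPolynomial.X i) P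

/-- All rows have degree less than `j` in `X_i`, so eliminating from the row of `X_i^j` leaves a
monic polynomial of degree `j`. -/
theorem exists_aeval_foldl_eliminate {m : MonomialOrder (Fin n)}
    {I : Ideal (MvPolynomial (Fin n) K)} {G : List (SPoly n K)} {i : Fin n} {j : ℕ}
    {L : List (SPoly n K × SPoly n K)} (hL : ∀ e ∈ L, IsRow m I G i j e)
    {v : SPoly n K × SPoly n K} (hv : toMv v.1 ∈ m.reduced (mvSet G))
    (hvI : toMv v.2 - toMv v.1 ∈ I) :
    toMv (L.foldl (eliminate m.test) v).1 ∈ m.reduced (mvSet G) ∧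
    toMv (L.foldl (eliminate m.test) v).2 - toMv (L.foldl (eliminate m.test) v).1 ∈ I ∧
    ∃ P : K[X], P.degree < j ∧
      toMv (L.foldl (eliminate m.test) v).2 = toMv v.2 - aeval (MvPolynomial.X i) P := by
  induction L generalizing v with
  | nil => exact ⟨hv, hvI, 0, by simp, by simp⟩
  | cons e L ih =>
    rw [List.foldl_cons]
    have he := hL e List.mem_cons_self
    obtain ⟨c, hc1, hc2⟩ := exists_toMv_eliminate m.test v e
    obtain ⟨P, hP, hP2⟩ := he.exists_aeval
    obtain ⟨h1, h2, Q, hQ, hQ2⟩ := ih (fun e he => hL e (List.mem_cons_of_mem _ he))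
      (v := eliminate m.test v e)
      (by rw [hc1]; exact sub_mem hv (Submodule.smul_mem _ _ he.reduced))
      (by
        rw [hc1, hc2, sub_sub_sub_comm, ← smul_sub, ← MvPolynomial.C_mul']
        exact sub_mem hvI (Ideal.mul_mem_left _ _ he.sub_mem))
    refine ⟨h1, h2, Q + c • P, ?_, ?_⟩
    · exact (degree_add_le _ _).trans_lt (max_lt hQ ((degree_smul_le _ _).trans_lt hP))
    · rw [hQ2, hc2, hP2, map_add, map_smul]
      ring

/-- The invariant of the search for the first linear dependence among the remainders of the powers
of `X_i`. -/
structure MonicGeneratorInv (m : MonomialOrder (Fin n)) (I : Ideal (MvPolynomial (Fin n) K))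
    (G : List (SPoly n K)) (i : Fin n) (s : ℕ × List (SPoly n K × SPoly n K)) : Prop where
  length_eq : s.2.length = s.1
  isRow : ∀ e ∈ s.2, IsRow m I G i s.1 e
  ne_zero : ∀ e ∈ s.2, toMv e.1 ≠ 0
  pairwise : s.2.Pairwise fun e e' => ∀ a, lm m.test e.1 = some a → coeff e'.1 a = 0
  independent : ∀ Q : K[X], Q.degree < s.1 → ∃ x ∈ m.reduced (mvSet G),
    aeval (MvPolynomial.X i) Q - x ∈ I ∧ (VanishesAtPivots m.test s.2 x → Q = 0 ∧ x = 0)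

/-- A later row vanishes at earlier pivots but not at its own, so the pivots are distinct. They are
standard monomials because the rows are reduced. -/
theorem MonicGeneratorInv.length_le {m : MonomialOrder (Fin n)}
    {I : Ideal (MvPolynomial (Fin n) K)} {G : List (SPoly n K)} {i : Fin n}
    {s : ℕ × List (SPoly n K × SPoly n K)} (h : MonicGeneratorInv m I G i s)
    {B : List (Fin n → ℕ)} (hB : ∀ a, a ∈ B ↔ ∀ g ∈ mvSet G, g ≠ 0 → ¬ m.degree g ≤ expo a) :
    s.1 ≤ B.length := by
  have hlm : ∀ e ∈ s.2, lm m.test e.1 = some ((lm m.test e.1).getD 0) ∧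
      coeff e.1 ((lm m.test e.1).getD 0) ≠ 0 := by
    intro e he
    rcases ha : lm m.test e.1 with _ | a
    · exact absurd (lm_eq_none.1 ha) (h.ne_zero e he)
    · refine ⟨rfl, ?_⟩
      rw [Option.getD_some, coeff_eq_leadingCoeff ha]
      exact m.leadingCoeff_ne_zero_iff.2 (h.ne_zero e he)
  have hnodup : (s.2.map fun e => (lm m.test e.1).getD 0).Nodup := by
    rw [List.Nodup, List.pairwise_map]
    refine h.pairwise.imp_of_mem fun {e e'} he he' hee' heq => ?_
    exact (hlm e' he').2 (heq ▸ hee' _ (hlm e he).1)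
  have hsub : (s.2.map fun e => (lm m.test e.1).getD 0) ⊆ B := by
    intro a ha
    obtain ⟨e, he, rfl⟩ := List.mem_map.1 ha
    refine (hB _).2 ((h.isRow e he).reduced _ ?_)
    rw [coeff_toMv]
    exact (hlm e he).2
  simpa [h.length_eq] using (hnodup.subperm hsub).length_le

/-- The reduced representative of an element of `I` is 0. It vanishes at all pivots, whence `Q = 0`
by the invariant. This gives minimality of the degree when the search stops. -/
theorem MonicGeneratorInv.eq_zero {m : MonomialOrder (Fin n)}
    {I : Ideal (MvPolynomial (Fin n) K)} {G : List (SPoly n K)} (hG : IsGroebner m I G) {i : Fin n}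
    {s : ℕ × List (SPoly n K × SPoly n K)} (h : MonicGeneratorInv m I G i s) {Q : K[X]}
    (hQ : Q.degree < s.1) (hQI : aeval (MvPolynomial.X i) Q ∈ I) : Q = 0 := by
  obtain ⟨x, hx, hxI, h1⟩ := h.independent Q hQ
  have hx0 := hG.eq_zero_of_mem_reduced (by simpa using sub_mem hQI hxI) hx
  exact (h1 (by simp [hx0, VanishesAtPivots])).1

theorem MonicGeneratorInv.append {m : MonomialOrder (Fin n)}
    {I : Ideal (MvPolynomial (Fin n) K)} {G : List (SPoly n K)} {i : Fin n} {j : ℕ}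
    {L : List (SPoly n K × SPoly n K)} (h : MonicGeneratorInv m I G i (j, L))
    {w : SPoly n K × SPoly n K} (hred : toMv w.1 ∈ m.reduced (mvSet G))
    (hI : toMv w.2 - toMv w.1 ∈ I) {P : K[X]} (hP : P.Monic) (hPj : P.degree = j)
    (hw : toMv w.2 = aeval (MvPolynomial.X i) P) (h0 : toMv w.1 ≠ 0)
    (hv : VanishesAtPivots m.test L (toMv w.1)) :
    MonicGeneratorInv m I G i (j + 1, L ++ [w]) := by
  have hj : (j : WithBot ℕ) < (j + 1 : ℕ) := by exact_mod_cast Nat.lt_succ_self j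
  refine ⟨by simp [h.length_eq], ?_, ?_, ?_, ?_⟩
  · intro e he
    rcases List.mem_append.1 he with he | he
    · obtain ⟨h1, h2, Q, hQ, hQ2⟩ := h.isRow e he
      exact ⟨h1, h2, Q, hQ.trans hj, hQ2⟩
    · rw [List.mem_singleton.1 he]
      exact ⟨hred, hI, P, hPj ▸ hj, hw⟩
  · intro e he
    rcases List.mem_append.1 he with he | he
    · exact h.ne_zero e he
    · rwa [List.mem_singleton.1 he]
  · refine List.pairwise_append.2 ⟨h.pairwise, List.pairwise_singleton _ _, fun e he e' he' a ha => ?_⟩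
    rw [List.mem_singleton.1 he', ← coeff_toMv]
    exact hv e he a ha
  · intro Q hQ
    -- Subtracting a multiple of the monic `P` reduces to the degrees already covered.
    have hQ' : (Q - Q.coeff j • P).degree < (j : ℕ) := by
      rw [degree_lt_iff_coeff_zero] at hQ ⊢
      intro k hk
      rw [coeff_sub, coeff_smul, smul_eq_mul]
      rcases hk.eq_or_lt with rfl | hk
      · have : P.coeff j = 1 := by
          rw [← natDegree_eq_of_degree_eq_some hPj]; exact hP
        rw [this, mul_one, sub_self]
      · rw [hQ k hk, coeff_eq_zero_of_degree_lt (n := k) (by rw [hPj]; exact_mod_cast hk), mul_zero,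
          sub_zero]
    obtain ⟨x, hx, hxI, h1⟩ := h.independent _ hQ'
    refine ⟨x + Q.coeff j • toMv w.1, add_mem hx (Submodule.smul_mem _ _ hred), ?_, fun hvan => ?_⟩
    · have : aeval (MvPolynomial.X i) Q - (x + Q.coeff j • toMv w.1) =
          (aeval (MvPolynomial.X i) (Q - Q.coeff j • P) - x) +
            Q.coeff j • (toMv w.2 - toMv w.1) := by
        rw [hw, map_sub, map_smul, smul_sub]
        ring
      rw [this, ← MvPolynomial.C_mul']
      exact add_mem hxI (Ideal.mul_mem_left _ _ hI)
    -- Since `w` vanishes at the old pivots, so does `x`, which is therefore 0. At the pivot of `w`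
    -- the remaining multiple of `w` then forces its coefficient to be 0.
    · obtain ⟨hQ0, hx0⟩ := h1 fun e he a ha => by
        have := hvan e (List.mem_append_left _ he) a ha
        rwa [MvPolynomial.coeff_add, MvPolynomial.coeff_smul, hv e he a ha, smul_zero,
          add_zero] at this
      rcases ha : lm m.test w.1 with _ | a
      · exact absurd (lm_eq_none.1 ha) h0
      have hc := hvan w (by simp) a ha
      rw [hx0, zero_add, MvPolynomial.coeff_smul, coeff_toMv, coeff_eq_leadingCoeff ha,
        smul_eq_mul, mul_eq_zero, or_iff_left (m.leadingCoeff_ne_zero_iff.2 h0)] at hc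
      rw [hc, zero_smul, sub_zero] at hQ0
      exact ⟨hQ0, by rw [hx0, hc, zero_smul, add_zero]⟩

theorem exists_mem_monicGenerator {m : MonomialOrder (Fin n)}
    {I : Ideal (MvPolynomial (Fin n) K)} {G : List (SPoly n K)} (hG : IsGroebner m I G)
    (hz : zeroDimensional m.test G = true) (i : Fin n) :
    ∃ p ∈ monicGenerator m.test G i, ∃ P : K[X], P.Monic ∧ P.degree = p.2 ∧
      toMv p.1 = aeval (MvPolynomial.X i) P ∧ aeval (MvPolynomial.X i) P ∈ I ∧
      ∀ Q : K[X], Q.degree < p.2 → aeval (MvPolynomial.X i) Q ∈ I → Q = 0 := by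
  -- The bound on the number of rows is used before the new row is added; the extra 1 keeps the
  -- measure decreasing when that bound is attained.
  refine PFun.exists_mem_fix (fun s => (monomialBasis m.test G).length + 1 - s.1)
    (P := MonicGeneratorInv m I G i) ?_ _
    ⟨rfl, by simp, by simp, by simp, fun Q hQ => ⟨0, zero_mem _, ?_⟩⟩
  · rintro ⟨j, L⟩ h
    obtain ⟨v, hv, hv1, hv2⟩ := hG.exists_mem_rem [(Pi.single i j, 1)]
    have hX : toMv [((Pi.single i j : Fin n → ℕ), (1 : K))] = MvPolynomial.X i ^ j := by
      simp [expo_single, MvPolynomial.X_pow_eq_monomial]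
    obtain ⟨h1, h2, P, hP, hP2⟩ := exists_aeval_foldl_eliminate h.isRow
      (v := (v, [(Pi.single i j, 1)])) hv2 hv1
    have hvan := vanishesAtPivots_foldl_eliminate h.pairwise (v, [(Pi.single i j, 1)])
    have hmonic : (X ^ j - P : K[X]).Monic := monic_X_pow_sub hP
    have hdeg : (X ^ j - P : K[X]).degree = j := by
      rw [degree_sub_eq_left_of_degree_lt] <;> rw [degree_X_pow]
      exact hP
    have haeval : toMv (L.foldl (eliminate m.test) (v, [(Pi.single i j, 1)])).2 =
        aeval (MvPolynomial.X i) (X ^ j - P : K[X]) := by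
      rw [hP2, hX]; simp
    by_cases h0 : toMv (L.foldl (eliminate m.test) (v, [(Pi.single i j, 1)])).1 = 0
    · left
      refine ⟨((L.foldl (eliminate m.test) (v, [(Pi.single i j, 1)])).2, j), ?_,
        X ^ j - P, hmonic, hdeg, haeval, ?_, fun Q hQ hQI => h.eq_zero hG hQ hQI⟩
      · rw [monicGeneratorStep, Part.mem_bind_iff]
        refine ⟨v, hv, ?_⟩
        simp only [if_pos (supp_eq_nil.2 h0)]
        exact Part.mem_some _
      · rwa [← haeval, ← sub_zero (toMv _), ← h0]
    · right
      refine ⟨(j + 1, L ++ [L.foldl (eliminate m.test) (v, [(Pi.single i j, 1)])]), ?_,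
        h.append h1 h2 hmonic hdeg haeval h0 hvan, ?_⟩
      · rw [monicGeneratorStep, Part.mem_bind_iff]
        refine ⟨v, hv, ?_⟩
        simp only [if_neg (mt supp_eq_nil.1 h0)]
        exact Part.mem_some _
      · have := h.length_le (mem_monomialBasis hz)
        dsimp only at this ⊢
        omega
  · have hQ0 : Q = 0 := by
      rw [← degree_eq_bot]
      simpa using hQ
    simp [hQ0]

end WeilAlg

/-! ### The specification of the procedure -/

namespace WeilAlg

open SPoly MonomialOrder Polynomial

variable {n : ℕ} {K : Type} [Field K]

theorem coeff_aeval_X (i : Fin n) (P : K[X]) (k : ℕ) :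
    (aeval (MvPolynomial.X i : MvPolynomial (Fin n) K) P).coeff (Finsupp.single i k) =
      P.coeff k := by
  induction P using Polynomial.induction_on' with
  | add p q hp hq => simp [hp, hq]
  | monomial d c =>
    rw [aeval_monomial, MvPolynomial.algebraMap_eq, MvPolynomial.coeff_C_mul,
      MvPolynomial.coeff_X_pow, coeff_monomial]
    have : Finsupp.single i d = Finsupp.single i k ↔ d = k :=
      (Finsupp.single_injective i).eq_iff
    simp [this]

/-- The coefficient at `d` is 1, so a single surviving monomial must be `X_i^d`. -/
theorem length_supp_eq_one_iff [DecidableEq K] {i : Fin n} {p : SPoly n K} {d : ℕ} {P : K[X]}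
    (hP : P.Monic) (hPd : P.degree = d) (hp : toMv p = aeval (MvPolynomial.X i) P) :
    (supp p).length = 1 ↔ P = X ^ d := by
  have hmem : ∀ k, (Pi.single i k : Fin n → ℕ) ∈ supp p ↔ P.coeff k ≠ 0 := fun k => by
    rw [mem_supp, ← coeff_toMv, hp, expo_single, coeff_aeval_X]
  constructor
  · rw [List.length_eq_one_iff]
    rintro ⟨a, ha⟩
    have hd : P.coeff d = 1 := by
      rw [← natDegree_eq_of_degree_eq_some hPd]; exact hP
    have h1 := (hmem d).2 (by rw [hd]; exact one_ne_zero)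
    rw [ha, List.mem_singleton] at h1
    ext k
    rw [coeff_X_pow]
    split_ifs with hk
    · rw [hk, hd]
    · by_contra h0
      have h2 := (hmem k).2 h0
      rw [ha, List.mem_singleton, ← h1] at h2
      exact hk (Pi.single_injective i h2)
  · rintro rfl
    rw [map_pow, aeval_X] at hp
    have : (supp p).Perm [Pi.single i d] := by
      refine (List.perm_ext_iff_of_nodup (nodup_supp p) (List.nodup_singleton _)).2 fun a => ?_
      rw [mem_supp, ← coeff_toMv, hp, MvPolynomial.coeff_X_pow, List.mem_singleton, ← expo_single]
      simp [eq_comm]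
    simpa using this.length_eq

/-- The remainder of `X^e` modulo `P` has degree below `d` and its value at `x` is in `I`, so it is
0 by minimality. A monic divisor of a power of the prime `X` is a power of `X`. -/
theorem eq_X_pow_of_X_pow_mem {R : Type*} [CommRing R] [Algebra K R] {I : Ideal R} {x : R}
    {P : K[X]} {d : ℕ} (hP : P.Monic) (hPd : P.degree = d) (hPI : aeval x P ∈ I)
    (hmin : ∀ Q : K[X], Q.degree < d → aeval x Q ∈ I → Q = 0) {e : ℕ} (he : x ^ e ∈ I) :
    P = X ^ d := by
  have hdvd : P ∣ X ^ e := by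
    rw [← modByMonic_eq_zero_iff_dvd hP]
    refine hmin _ (hPd ▸ degree_modByMonic_lt _ hP) ?_
    rw [modByMonic_eq_sub_mul_div _ P, map_sub, map_mul, map_pow, aeval_X]
    exact sub_mem he (Ideal.mul_mem_right _ _ hPI)
  obtain ⟨k, -, hk⟩ := (dvd_prime_pow prime_X e).1 hdvd
  have hk := eq_of_monic_of_associated hP (monic_X_pow k) hk
  rw [hk, degree_X_pow] at hPd
  rw [hk, show k = d from by exact_mod_cast hPd]

/-- Minimality of the degree `d` keeps lower powers of `X_i` out of `I`, while `X_i^d ∈ I` brings in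
all higher ones. -/
theorem exists_mem_maxPowers [DecidableEq K] {m : MonomialOrder (Fin n)}
    {I : Ideal (MvPolynomial (Fin n) K)} {G : List (SPoly n K)} (hG : IsGroebner m I G)
    (hz : zeroDimensional m.test G = true) (l : List (Fin n)) (k : Fin n → ℕ) :
    (none ∈ maxPowers m.test G l k ∧
      ∃ i, ∀ e : ℕ, (MvPolynomial.X i : MvPolynomial (Fin n) K) ^ e ∉ I) ∨
    ∃ k', some k' ∈ maxPowers m.test G l k ∧ (∀ i ∉ l, k' i = k i) ∧
      ∀ i ∈ l, ∃ d, k' i = d - 1 ∧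
        ∀ e : ℕ, (MvPolynomial.X i : MvPolynomial (Fin n) K) ^ e ∈ I ↔ d ≤ e := by
  induction l generalizing k with
  | nil => exact Or.inr ⟨k, by simp [maxPowers], by simp, by simp⟩
  | cons i l ih =>
    obtain ⟨⟨p, d⟩, hp, P, hP, hPd, hpP, hPI, hmin⟩ := exists_mem_monicGenerator hG hz i
    dsimp only at hPd hpP hmin
    have hlen := length_supp_eq_one_iff hP hPd hpP
    simp only [maxPowers, Part.mem_bind_iff]
    by_cases h1 : P = X ^ d
    · have hpow : ∀ e : ℕ, (MvPolynomial.X i : MvPolynomial (Fin n) K) ^ e ∈ I ↔ d ≤ e := by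
        refine fun e => ⟨fun he => ?_, fun he => ?_⟩
        · by_contra hlt
          refine pow_ne_zero e (X_ne_zero (R := K)) (hmin (X ^ e) ?_ (by simpa using he))
          rw [degree_X_pow]
          exact_mod_cast not_le.1 hlt
        · rw [h1, map_pow, aeval_X] at hPI
          exact Ideal.mem_of_dvd I (pow_dvd_pow _ he) hPI
      rcases ih (Function.update k i (d - 1)) with ⟨hn, hi⟩ | ⟨k', hk', hout, hin⟩
      · exact Or.inl ⟨⟨_, hp, by rw [if_pos (hlen.2 h1)]; exact hn⟩, hi⟩
      · refine Or.inr ⟨k', ⟨_, hp, by rw [if_pos (hlen.2 h1)]; exact hk'⟩, ?_, ?_⟩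
        · intro j hj
          rw [List.mem_cons, not_or] at hj
          rw [hout j hj.2, Function.update_of_ne hj.1]
        · intro j hj
          by_cases hjl : j ∈ l
          · exact hin j hjl
          · obtain rfl := (List.mem_cons.1 hj).resolve_right hjl
            exact ⟨d, by rw [hout j hjl, Function.update_self], hpow⟩
    · refine Or.inl ⟨⟨_, hp, ?_⟩, i, fun e he => h1 (eq_X_pow_of_X_pow_mem hP hPd hPI hmin he)⟩
      rw [if_neg (mt hlen.1 h1)]
      exact Part.mem_some _

end WeilAlg

/-- The condition on the variables says that they lie in the radical of `I`; noetherianity then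
gives one exponent for the ideal they generate. -/
theorem isWeil_iff_exists_pow_mem {n : ℕ} {I : Ideal (MvPolynomial (Fin n) ℝ)} :
    IsWeil I ↔ ∀ i, ∃ e : ℕ, (MvPolynomial.X i : MvPolynomial (Fin n) ℝ) ^ e ∈ I := by
  constructor
  · rintro ⟨k, hk⟩ i
    exact ⟨k, hk (Ideal.pow_mem_pow (Ideal.subset_span (Set.mem_range_self i)) k)⟩
  · intro h
    refine Ideal.exists_pow_le_of_le_radical_of_fg (Ideal.span_le.2 ?_)
      (IsNoetherian.noetherian _)
    rintro _ ⟨i, rfl⟩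
    exact h i

open WeilAlg in
theorem weilTest_spec {n : ℕ} [DecidableEq ℝ] (m : MonomialOrder (Fin n))
    (F : List (SPoly n ℝ)) :
    (none ∈ weilTest m.test F ∧ ¬ IsWeil (idealOf F)) ∨
      ∃ S, some S ∈ weilTest m.test F ∧ IsWeil (idealOf F) ∧ IsWeilSetting (idealOf F) S := by
  obtain ⟨G, hGF, hG⟩ := exists_mem_calcGroebnerBasis m F
  simp only [weilTest, Part.mem_bind_iff, isWeil_iff_exists_pow_mem]
  by_cases hz : zeroDimensional m.test G = true
  -- The multiplication table is computed before the variables are tested, so its termination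
  -- matters for the answer "No" as well.
  · obtain ⟨M, hM, hkeys, hspec⟩ := exists_mem_multTable hG hz
    rcases exists_mem_maxPowers hG hz (List.finRange n) 0 with ⟨hn, i, hi⟩ | ⟨k, hk, -, hkI⟩
    · refine Or.inl ⟨⟨G, hGF, ?_⟩, fun h => (h i).elim hi⟩
      rw [if_neg (by simp [hz])]
      exact Part.mem_bind_iff.2 ⟨M, hM, Part.mem_bind_iff.2 ⟨_, hn, Part.mem_some _⟩⟩
    · obtain ⟨N, hN, hNkeys, hNspec⟩ := exists_mem_nonVanTable hG hz k
      refine Or.inr ⟨⟨monomialBasis m.test G, M, k, N⟩, ⟨G, hGF, ?_⟩, fun i => ?_,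
        linearIndependent_monomialClass hG hz, span_monomialClass_eq_top hG hz, hkeys, hspec,
        fun hI i => ?_, hNkeys, hNspec⟩
      · rw [if_neg (by simp [hz])]
        exact Part.mem_bind_iff.2 ⟨M, hM, Part.mem_bind_iff.2 ⟨_, hk,
          Part.mem_bind_iff.2 ⟨N, hN, Part.mem_some _⟩⟩⟩
      · obtain ⟨d, -, hd⟩ := hkI i (List.mem_finRange i)
        exact ⟨d, (hd d).2 le_rfl⟩
      · obtain ⟨d, hkd, hd⟩ := hkI i (List.mem_finRange i)
        -- With `d = 0` the ideal would contain 1; otherwise the truncated `d - 1` is a genuine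
        -- predecessor.
        have hd0 : d ≠ 0 := by
          rintro rfl
          refine hI ((Ideal.eq_top_iff_one _).2 ?_)
          simpa using (hd 0).2 le_rfl
        simp only [hkd, hd]
        refine ⟨?_, fun j hj => ?_⟩
        · simp only [Set.mem_ofPred_eq]; omega
        · simp only [Set.mem_ofPred_eq] at hj; omega
  · refine Or.inl ⟨⟨G, hGF, ?_⟩, fun h => hz (hG.zeroDimensional h)⟩
    rw [if_pos (by simpa using hz)]
    exact Part.mem_some _

/-! ### Finite generation, nilpotent classes and the theorem -/

theorem exists_idealOf_eq {n : ℕ} {K : Type} [Field K] (I : Ideal (MvPolynomial (Fin n) K)) :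
    ∃ F : List (SPoly n K), idealOf F = I := by
  obtain ⟨s, hs⟩ := IsNoetherian.noetherian I
  choose p hp using SPoly.exists_toMv_eq (n := n) (K := K)
  refine ⟨s.toList.map p, ?_⟩
  rw [idealOf, ← hs, Ideal.span]
  congr 1
  ext f
  simp [hp]

open Polynomial in
-- Nilpotency says that some `X^e` lies in the contracted ideal. That ideal is principal, and a
-- divisor of `X^e` is a power of `X` up to a unit.
theorem isNilpotent_mk_iff_comap_eq_span {K R : Type*} [Field K] [CommRing R] [Algebra K R]
    (I : Ideal R) (x : R) :
    IsNilpotent (Ideal.Quotient.mk I x) ↔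
      ∃ p : K[X], p.Monic ∧ Ideal.comap (aeval x) I = Ideal.span {p} ∧
        ∃ d : ℕ, p = monomial d 1 := by
  have hpow : ∀ e : ℕ, Ideal.Quotient.mk I x ^ e = 0 ↔
      (X ^ e : K[X]) ∈ Ideal.comap (aeval x) I := fun e => by
    rw [← map_pow, Ideal.Quotient.eq_zero_iff_mem, Ideal.mem_comap, map_pow, aeval_X]
  constructor
  · rintro ⟨e, he⟩
    rw [hpow] at he
    obtain ⟨q, hq⟩ := IsPrincipalIdealRing.principal (Ideal.comap (aeval x) I : Ideal K[X])
    rw [Ideal.submodule_span_eq] at hq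
    rw [hq, Ideal.mem_span_singleton] at he
    obtain ⟨d, -, hd⟩ := (dvd_prime_pow prime_X e).1 he
    refine ⟨X ^ d, monic_X_pow d, ?_, d, (monomial_one_right_eq_X_pow d).symm⟩
    rw [hq, Ideal.span_singleton_eq_span_singleton]
    exact hd
  · rintro ⟨p, -, hp, d, rfl⟩
    refine ⟨d, (hpow d).2 ?_⟩
    rw [hp, monomial_one_right_eq_X_pow]
    exact Ideal.mem_span_singleton_self _

theorem mainTheorem1 (n : ℕ) (m : MonomialOrder (Fin n)) (I : Ideal (MvPolynomial (Fin n) ℝ)) :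
    -- the input: every ideal is given by a finite list of generators
    (∃ F : List (SPoly n ℝ), idealOf F = I) ∧
    (∀ F : List (SPoly n ℝ), idealOf F = I →
      (weilTest m.test F).Dom ∧
      (none ∈ weilTest m.test F ↔ ¬ IsWeil I) ∧
      (IsWeil I → ∃ S, some S ∈ weilTest m.test F ∧ IsWeilSetting I S)) ∧
    (∀ i : Fin n,
      IsNilpotent (Ideal.Quotient.mk I (MvPolynomial.X i)) ↔
        ∃ p : Polynomial ℝ, p.Monic ∧
          Ideal.comap (Polynomial.aeval (MvPolynomial.X i : MvPolynomial (Fin n) ℝ)) I =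
            Ideal.span {p} ∧
          ∃ d : ℕ, p = Polynomial.monomial d 1) := by
  refine ⟨exists_idealOf_eq I, ?_, fun i => isNilpotent_mk_iff_comap_eq_span I _⟩
  rintro F rfl
  rcases weilTest_spec m F with ⟨hn, hW⟩ | ⟨S, hS, hW, hSW⟩
  · exact ⟨Part.dom_iff_mem.2 ⟨_, hn⟩, iff_of_true hn hW, fun h => absurd h hW⟩
  · refine ⟨Part.dom_iff_mem.2 ⟨_, hS⟩, iff_of_false (fun hn => ?_) (not_not.2 hW),
      fun _ => ⟨S, hS, hSW⟩⟩
    cases Part.mem_unique hn hS
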